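/- **Setting.** A finite simple graph is maintained as the set $\mathcal G$ of its connected components, each given by a pair $(T,E^n)$ of a spanning tree $T$ and the set $E^n$ of its non-tree edges. The tree $T$ is stored as an Euler tour (one node per vertex and one node per direction of each tree edge, in the cyclic order of a traversal that passes every edge once in each direction) in a splay tree, of any shape; the vertices of $T$ and the edges in $E^n$ are stored in hash sets, and a hash table maps vertices and directed tree edges to their splay tree nodes. Time is the number of elementary steps: rotations, pointer and field accesses, comparisons, creation and deletion of nodes, and hash operations on one element. Two sets $E^n$ are united by inserting the elements of the smaller into the larger. $\mathtt{FindCC}(v)$ splays the node of $v$ and returns its component; $\mathtt{Link}(u,v)$ joins two trees by the edge $(u,v)$; $\mathtt{Cut}(u,v)$ removes the tree edge $(u,v)$ and returns the two trees. $\mathtt{DecUpdateCC}(\mathcal G,V^d,E^d)$ does the following for each $(u,v)\in E^d$: it calls $\mathtt{FindCC}(u)$, which gives $(T,E^n)$; if $(u,v)\in E^n$, it removes $(u,v)$ from $E^n$; otherwise it calls $\mathtt{Cut}(u,v)$ and scans $E^n$, in any order, for an edge $(x,y)$ between the two trees; if there is one, it calls $\mathtt{Link}(x,y)$ and removes $(x,y)$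 from $E^n$, and otherwise it replaces the component by two, splitting $E^n$ accordingly. Then it removes the vertices in $V^d$, which are now isolated, and updates the vertex sets. $\mathtt{IncUpdateCC}(\mathcal G,V^d,E^d)$ adds the vertices in $V^d$ as isolated components; for each $(u,v)\in E^d$ it calls $\mathtt{FindCC}(u)$ and $\mathtt{FindCC}(v)$; if $u$ and $v$ are in different trees, it calls $\mathtt{Link}(u,v)$ and unites the two sets of non-tree edges, and otherwise it adds $(u,v)$ to $E^n$. Then it updates the vertex sets. **Theorem.** There is an absolute constant $C>0$ such that the following holds. Let $G=(V,E)$ be a finite simple graph, $V^d\subseteq V$, and let $E^d\subseteq E$ contain all edges incident to $V^d$. Let $H=(V\setminus V^d,E\setminus E^d)$. 1. In the amortized sense, $\mathtt{FindCC}$ takes time at most $C(1+\log|V|)$, and $\mathtt{Link}$ and $\mathtt{Cut}$ take time at most $C\log|V|$, and they are correct. (Precisely: there is a potential $\varphi$ on splay trees with $0\le\varphi(t)\le C\,|t|\log|t|$, where $|t|$ is the number of nodes, such that the time plus the change of the total potential of the splay trees involved is at most the stated bound; for $\mathtt{Link}$ and $\mathtt{Cut}$ even with the number of vertices of the joined,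 respectively cut, tree in place of $|V|$.) 2. Started with any representation of $G$, $\mathtt{DecUpdateCC}(\mathcal G,V^d,E^d)$ ends with a representation of $H$ and takes time at most $C\bigl(|E^d|(\log|V|+|E|)+|V|\bigr)$, both in the worst case and in the amortized sense. 3. Started with any representation of $H$, $\mathtt{IncUpdateCC}(\mathcal G,V^d,E^d)$ ends with a representation of $G$ and takes amortized time at most $C\bigl(|E^d|\log|V|+|V|\bigr)$. In 2 and 3, amortized time refers to one common potential $\Phi\ge 0$ on the states of the data structure, with $\Phi\le C\,(|V|+|E|)\log|V|$ at every representation of a graph $(V,E)$: the time of a call plus the change of $\Phi$ is at most the stated bound. In particular, any sequence of calls of the two algorithms that starts with the empty graph takes in total at most the sum of the stated bounds. -/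

import Mathlib

/-!
Dynamic connected components: decremental and incremental updates of a spanning forest whose trees
are stored as Euler tours in splay trees, together with the number of elementary steps performed.
-/

namespace DynCC

/-! ### Step counting -/

/-- A computation that returns `val` after `time` elementary steps. -/
structure Timed (β : Type*) where
  val : β
  time : ℕ

instance : Monad Timed where
  pure b := ⟨b, 0⟩
  bind x f := ⟨(f x.val).val, x.time + (f x.val).time⟩

/-- `n` elementary steps with the joint result `b`. An elementary step consists of a constant
number of accesses to fields of tree nodes or of component records, comparisons, creations or
deletions of nodes, or accesses to a hash set or a hash table (look-up, insertion or deletion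
of one element). -/
def steps {β : Type*} (n : ℕ) (b : β) : Timed β := ⟨b, n⟩

/-- One elementary step. -/
def step {β : Type*} (b : β) : Timed β := steps 1 b

/-- One elementary step whose effect is described by the surrounding code. -/
def tick : Timed PUnit := step PUnit.unit

/-- The union of two hash sets: the elements of the smaller one are inserted, one by one, into
the larger one. -/
def hashUnion {β : Type*} [DecidableEq β] (A B : Finset β) : Timed (Finset β) :=
  steps (min A.card B.card + 1) (A ∪ B)

/-! ### Splay trees -/

/-- Binary trees; the represented sequence is the in-order sequence. -/
inductive SplayTree (κ : Type*) where
  | nil : SplayTree κ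
  | node (left : SplayTree κ) (value : κ) (right : SplayTree κ) : SplayTree κ

namespace SplayTree

variable {κ : Type*}

/-- The in-order sequence of the values. -/
def toList : SplayTree κ → List κ
  | nil => []
  | node l x r => l.toList ++ x :: r.toList

/-- The number of nodes. It is the content of the `size` field of the root, so that reading it
is an elementary step. -/
def size : SplayTree κ → ℕ
  | nil => 0
  | node l _ r => l.size + r.size + 1

/-- The tree with one node. -/
def single (x : κ) : SplayTree κ := node nil x nil

/-- What a node sees when it follows its parent pointer. `left p c`: the node is the left child of
a node with value `p` whose right subtree is `c`. `right a p`: the node is the right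
child of a node with value `p` whose left subtree is `a`. -/
inductive Frame (κ : Type*) where
  | left (p : κ) (c : SplayTree κ) : Frame κ
  | right (a : SplayTree κ) (p : κ) : Frame κ

/-- The node with value `x`: its left subtree, its right subtree and its ancestors, the
parent first and the root last. The accumulator holds the ancestors of the given subtree.
This only describes what a pointer to the node gives access to; it is not a search. -/
def locate [DecidableEq κ] (x : κ) : SplayTree κ → List (Frame κ) →
    Option (SplayTree κ × SplayTree κ × List (Frame κ))
  | nil, _ => none
  | node l k r, fs =>
      if k = x then some (l, r, fs)
      else (locate x l (Frame.left k r :: fs)).orElse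
        fun _ => locate x r (Frame.right l k :: fs)

/-- Bottom-up splaying of a node with subtrees `l` and `r`: rotations move the node upwards until
it has no ancestor left, one step per rotation, and one step for the final test.
The cases are: root; zig (twice); zig-zig (twice), where the parent is rotated
before the node; zig-zag (twice), where the node is rotated two times.
The result is the pair of subtrees of the node once it is the root. -/
def splayUp : SplayTree κ → SplayTree κ → List (Frame κ) → Timed (SplayTree κ × SplayTree κ)
  | l, r, [] => step (l, r)
  | l, r, [Frame.left p c] => steps 2 (l, node r p c)
  | l, r, [Frame.right a p] => steps 2 (node a p l, r)
  | l, r, Frame.left p c :: Frame.left g d :: fs => do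
      let z ← steps 2 (l, node r p (node c g d))
      splayUp z.1 z.2 fs
  | l, r, Frame.right a p :: Frame.right b g :: fs => do
      let z ← steps 2 (node (node b g a) p l, r)
      splayUp z.1 z.2 fs
  | l, r, Frame.left p c :: Frame.right b g :: fs => do
      let z ← steps 2 (node b g l, node r p c)
      splayUp z.1 z.2 fs
  | l, r, Frame.right a p :: Frame.left g d :: fs => do
      let z ← steps 2 (node a p l, node r g d)
      splayUp z.1 z.2 fs

/-- Splay the node with value `x`, found through a hash table from values to nodes (one step).
The result is the pair of subtrees of `x`, which is then the value of the root. (If `x` does not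
occur, the result is meaningless.) -/
def splay [DecidableEq κ] (x : κ) (t : SplayTree κ) : Timed (SplayTree κ × SplayTree κ) := do
  let z ← step (locate x t [])
  match z with
  | none => pure (nil, nil)
  | some (l, r, fs) => splayUp l r fs

/-- Walk from the root of `node l x r` along right children to the last node and return its
value, one step per visited node. -/
def lastValue (x : κ) : SplayTree κ → Timed κ
  | nil => step x
  | node _ y r => do
      tick
      lastValue y r

/-- Concatenation of two sequences: the last node of the first tree is splayed, and the second
tree becomes its right child. -/
def concat [DecidableEq κ] : SplayTree κ → SplayTree κ → Timed (SplayTree κ)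
  | nil, t => step t
  | node l x r, nil => step (node l x r)
  | node l x r, t => do
      let y ← lastValue x r
      let z ← splay y (node l x r)
      step (node z.1 y t)

end SplayTree

/-! ### Euler tours -/

/-- The nodes of an Euler tour: one node for every vertex, and one node for each of the two
directed edges that belong to an edge of the tree. -/
inductive TourNode (α : Type*) where
  | vtx (v : α) : TourNode α
  | arc (u v : α) : TourNode α
  deriving DecidableEq

namespace TourNode

variable {α : Type*}

/-- The vertex at which the traversal is before it passes a node of the tour. -/
def source : TourNode α → α
  | vtx v => v
  | arc u _ => u

/-- The vertex at which the traversal is after it has passed a node of the tour. -/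
def target : TourNode α → α
  | vtx v => v
  | arc _ v => v

/-- The undirected tree edge of a node of the tour. -/
def edge? : TourNode α → Option (Sym2 α)
  | vtx _ => none
  | arc u v => some s(u, v)

end TourNode

open SplayTree TourNode

/-- `l` is an Euler tour of a tree with vertex set `W` and edge set `F`: a closed walk that
traverses each edge exactly twice, once in each direction, and in which each vertex
is marked exactly once. -/
structure IsEulerTour {α : Type*} (l : List (TourNode α)) (W : Finset α)
    (F : Finset (Sym2 α)) : Prop where
  edge_mem : ∀ e ∈ F, ¬ e.IsDiag ∧ ∀ v ∈ e, v ∈ W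
  isTree : ((SimpleGraph.fromEdgeSet (F : Set (Sym2 α))).induce (W : Set α)).IsTree
  nodup : l.Nodup
  vtx_mem : ∀ v, vtx v ∈ l ↔ v ∈ W
  arc_mem : ∀ u v, arc u v ∈ l ↔ s(u, v) ∈ F
  walk : l.IsChain fun a b => a.target = b.source
  closed : ∀ a ∈ l.getLast?, ∀ b ∈ l.head?, a.target = b.source

section Algorithms

variable {α : Type*} [DecidableEq α]

/-- Rotate the (cyclic) tour in `t` so that it starts with the node of `u`. -/
def adjustHead (u : α) (t : SplayTree (TourNode α)) : Timed (SplayTree (TourNode α)) := do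
  let z ← splay (vtx u) t
  let w ← step (node nil (vtx u) z.2)
  concat w z.1

/-- Join the trees with tours `s`, which contains `u`, and `t`, which contains `v`, by the edge
between `u` and `v`. -/
def link (u v : α) (s t : SplayTree (TourNode α)) : Timed (SplayTree (TourNode α)) := do
  let s₁ ← adjustHead u s
  let t₁ ← adjustHead v t
  let a ← step (single (arc u v))
  let b ← step (single (arc v u))
  let n₁ ← concat s₁ a
  let n₂ ← concat n₁ t₁
  concat n₂ b

/-- Remove the tree edge between `u` and `v`. The result is the pair of tours of the tree that
contains `u` and of the tree that contains `v`. -/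
def cut (u v : α) (t : SplayTree (TourNode α)) :
    Timed (SplayTree (TourNode α) × SplayTree (TourNode α)) := do
  let z ← splay (arc u v) t
  tick -- the node `arc u v` is deleted
  let n ← concat z.2 z.1
  let w ← splay (arc v u) n
  tick -- the node `arc v u` is deleted
  pure (w.2, w.1)

/-- The hash set of the vertices of a tour, by a traversal of all its nodes; the vertices are
added to the accumulator. -/
def collect : SplayTree (TourNode α) → Finset α → Timed (Finset α)
  | nil, A => pure A
  | node l x r, A => do
      let A₁ ← collect l A
      let A₂ ← step (match x with
        | vtx v => insert v A₁
        | arc _ _ => A₁)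
      collect r A₂

/-! ### Connected components -/

/-- A connected component: the Euler tour of a spanning tree, the hash set of its vertices, and
the hash set of the non-tree edges. -/
structure Component (α : Type*) where
  tree : SplayTree (TourNode α)
  verts : Finset α
  nontree : Finset (Sym2 α)

/-- The edges of the spanning tree. -/
def Component.treeEdges (c : Component α) : Finset (Sym2 α) :=
  (c.tree.toList.filterMap edge?).toFinset

/-- The component whose spanning tree contains the node of `v`, and the other components. This
only describes what a pointer to the node of `v` gives access to; it is not a search. (If there is
no such component, the result is meaningless.) -/
def extract (v : α) (S : List (Component α)) : Component α × List (Component α) :=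
  ((S.find? fun c => decide (vtx v ∈ c.tree.toList)).getD ⟨nil, ∅, ∅⟩,
    S.eraseP fun c => decide (vtx v ∈ c.tree.toList))

/-- `FindCC`: the node of `v` is splayed; it is then the root of its spanning tree, and the root
gives access to the record of the component. The result is this component and
the list of the other ones. -/
def findCC (v : α) (S : List (Component α)) : Timed (Component α × List (Component α)) := do
  let c ← step (extract v S)
  let z ← splay (vtx v) c.1.tree
  pure (⟨node z.1 (vtx v) z.2, c.1.verts, c.1.nontree⟩, c.2)

/-- The vertex sets of all components are computed anew from the Euler tours. -/
def rebuild : List (Component α) → Timed (List (Component α))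
  | [] => pure []
  | c :: S => do
      let W ← collect c.tree ∅
      let S' ← rebuild S
      pure (⟨c.tree, W, c.nontree⟩ :: S')

/-! ### The decremental update -/

/-- The search for a replacement edge in a list of non-tree edges, where `W` is the vertex set
of the tree `T_v`. Either an edge with exactly one end in `W` is found, or the result
is the set of edges without end in `W` and the set of edges with both ends in `W`
(each of them added to an accumulator). -/
def search (W : Finset α) : List (α × α) → Finset (Sym2 α) → Finset (Sym2 α) →
    Timed ((α × α) ⊕ (Finset (Sym2 α) × Finset (Sym2 α)))
  | [], A, B => pure (Sum.inr (A, B))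
  | (x, y) :: L, A, B => do
      tick -- look up `x`
      tick -- look up `y`
      if ¬ (x ∈ W ↔ y ∈ W) then
        pure (Sum.inl (x, y))
      else if x ∉ W then do
        let A' ← step (insert s(x, y) A)
        search W L A' B
      else do
        let B' ← step (insert s(x, y) B)
        search W L A B'

/-- The deletion of one edge. The function `ord` gives the order in which the elements of a
hash set of edges are visited. The hash set of the vertices of the smaller one of the two
trees is computed by a traversal of its Euler tour. -/
def deleteEdge (ord : Finset (Sym2 α) → List (α × α)) (u v : α) (S : List (Component α)) :
    Timed (List (Component α)) := do
  let f ← findCC u S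
  let c := f.1
  tick -- look up the edge
  if s(u, v) ∈ c.nontree then do
    let N ← step (c.nontree.erase s(u, v))
    pure (⟨c.tree, c.verts, N⟩ :: f.2)
  else do
    let z ← cut u v c.tree
    let w ← step (if z.1.size < z.2.size then (z.2, z.1) else z)
    let W ← collect w.2 ∅
    let found ← search W (ord c.nontree) ∅ ∅
    match found with
    | Sum.inl (x, y) => do
        tick -- look up `x`
        let T ← if x ∈ W then link x y w.2 w.1 else link x y w.1 w.2
        let N ← step (c.nontree.erase s(x, y))
        pure (⟨T, c.verts, N⟩ :: f.2)
    | Sum.inr (A, B) =>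
        step (⟨w.1, c.verts, A⟩ :: ⟨w.2, c.verts, B⟩ :: f.2)

/-- The deletion of the edges of a list, one after the other. -/
def deleteEdges (ord : Finset (Sym2 α) → List (α × α)) :
    List (α × α) → List (Component α) → Timed (List (Component α))
  | [], S => pure S
  | (u, v) :: L, S => do
      let S' ← deleteEdge ord u v S
      deleteEdges ord L S'

/-- The removal of components that consist of a single vertex, for the vertices of a list. -/
def deleteVertices : List α → List (Component α) → Timed (List (Component α))
  | [], S => pure S
  | v :: L, S => do
      let S' ← step (S.filter fun c => decide (¬ (c.tree.toList = [vtx v] ∧ c.nontree = ∅)))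
      deleteVertices L S'

/-- `DecUpdateCC`: delete the edges in `Ed` and then the vertices in `Vd`, and bring the vertex
sets of the components up to date. -/
def decUpdateCC (ord : Finset (Sym2 α) → List (α × α)) (S : List (Component α))
    (Vd : List α) (Ed : List (α × α)) : Timed (List (Component α)) := do
  let S₁ ← deleteEdges ord Ed S
  let S₂ ← deleteVertices Vd S₁
  rebuild S₂

/-! ### The incremental update -/

/-- The insertion of isolated vertices. -/
def insertVertices : List α → List (Component α) → Timed (List (Component α))
  | [], S => pure S
  | v :: L, S => do
      let S' ← step (⟨single (vtx v), {v}, ∅⟩ :: S)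
      insertVertices L S'

/-- The insertion of one edge. After both calls of `findCC`, the node of `v` is a root, and the
ends are in the same tree if and only if the node of `u` is not the root of another tree. -/
def insertEdge (u v : α) (S : List (Component α)) : Timed (List (Component α)) := do
  let f ← findCC u S
  let g ← findCC v (f.1 :: f.2)
  tick -- compare the trees
  if vtx u ∈ g.1.tree.toList then do
    let N ← step (insert s(u, v) g.1.nontree)
    pure (⟨g.1.tree, g.1.verts, N⟩ :: g.2)
  else do
    let h := extract u g.2
    let T ← link u v h.1.tree g.1.tree
    let N ← hashUnion h.1.nontree g.1.nontree
    step (⟨T, h.1.verts, N⟩ :: h.2)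

/-- The insertion of the edges of a list, one after the other. -/
def insertEdges : List (α × α) → List (Component α) → Timed (List (Component α))
  | [], S => pure S
  | (u, v) :: L, S => do
      let S' ← insertEdge u v S
      insertEdges L S'

/-- `IncUpdateCC`: insert the vertices in `Vd` and then the edges in `Ed`, and bring the vertex
sets of the components up to date. -/
def incUpdateCC (S : List (Component α)) (Vd : List α) (Ed : List (α × α)) :
    Timed (List (Component α)) := do
  let S₁ ← insertVertices Vd S
  let S₂ ← insertEdges Ed S₁
  rebuild S₂

end Algorithms

/-! ### Graphs and what a set of components represents -/

/-- A finite simple undirected graph whose vertices are taken from the type `α`. -/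
structure FinGraph (α : Type*) where
  verts : Finset α
  edges : Finset (Sym2 α)
  mem_verts : ∀ e ∈ edges, ∀ v ∈ e, v ∈ verts
  loopless : ∀ e ∈ edges, ¬ e.IsDiag

section Specification

variable {α : Type*} [DecidableEq α]

/-- `S` is a correct representation of the connected components of `G`, each of them by the Euler
tour of some spanning tree in a splay tree of any shape, the set of its vertices, and the set of its
edges outside the spanning tree. -/
structure Represents (S : List (Component α)) (G : FinGraph α) : Prop where
  tour : ∀ c ∈ S, IsEulerTour c.tree.toList c.verts c.treeEdges
  nontree_mem : ∀ c ∈ S, ∀ e ∈ c.nontree, ∀ v ∈ e, v ∈ c.verts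
  disjoint_edges : ∀ c ∈ S, Disjoint c.treeEdges c.nontree
  disjoint_verts : S.Pairwise fun c d => Disjoint c.verts d.verts
  verts : ∀ v, v ∈ G.verts ↔ ∃ c ∈ S, v ∈ c.verts
  edges : ∀ e, e ∈ G.edges ↔ ∃ c ∈ S, e ∈ c.treeEdges ∨ e ∈ c.nontree

/-- The undirected edges given by a list of pairs. -/
def undirected (L : List (α × α)) : List (Sym2 α) := L.map fun p => s(p.1, p.2)

/-- `H` arises from `G` by the deletion of the edges in `Ed` and of the vertices in `Vd` (and `G`
arises from `H` by their insertion). As `H` is a graph, `Ed` contains all edges of `G` that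
are incident to a vertex in `Vd`. -/
structure Deletion (G : FinGraph α) (Vd : List α) (Ed : List (α × α)) (H : FinGraph α) : Prop where
  nodup_verts : Vd.Nodup
  nodup_edges : (undirected Ed).Nodup
  subset_verts : ∀ v ∈ Vd, v ∈ G.verts
  subset_edges : ∀ e ∈ undirected Ed, e ∈ G.edges
  verts : H.verts = G.verts \ Vd.toFinset
  edges : H.edges = G.edges \ (undirected Ed).toFinset

/-- `ord` lists the elements of each finite set of edges, each of them once and in one direction,
in an arbitrary order. -/
def IsEnumeration (ord : Finset (Sym2 α) → List (α × α)) : Prop :=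
  ∀ A : Finset (Sym2 α), (undirected (ord A)).Nodup ∧ (undirected (ord A)).toFinset = A

end Specification

end DynCC

open DynCC

-- A splay tree carries as potential four times the sum of the logarithms of all its subtree sizes.
-- By the access lemma `splayUp_logSum`, whose core is the AM–GM inequality `log_add_log_le`, a
-- splay in a tree with n nodes then costs O(1 + log n) amortized. Linking and cutting consist of
-- boundedly many splays, concatenations and pointer changes, so they inherit this bound
-- (`link_spec`, `cut_spec`); an Euler tour of a tree with k vertices has at most 3k nodes.
--
-- Correctness of the tours rests on a count. A closed walk along edges of F that marks every vertex
-- of W shows that W is connected, so F is a spanning tree exactly when |F| + 1 = |W|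
-- (`isEulerTour_iff`). Two closed walks joined by an edge passed in both directions form a closed
-- walk with the right count (`IsEulerTour.join`). Conversely, deleting both arcs of an edge leaves
-- two closed walks; each has at most one vertex more than it has edges, and the totals force
-- equality in both (`IsEulerTour.split`).
--
-- For the non-tree edges, `statePotential` adds 2 (M log M − Σ k log k), where M is their total
-- number and k runs over the sizes of the single sets. This is an entropy of the partition: it is
-- nonnegative because n log n is superadditive, and uniting sets of sizes a and b lowers it by at
-- least min(a, b), which pays for the union (`min_le_mulLog`). Adding an edge raises it by O(log
-- M), hence by O(log |V|) since M ≤ |V|². Removing an edge from a set of size k or splitting such a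
-- set raises it by at most 2k, which the |E| term of the decremental bound absorbs.
--
-- In the worst case a deletion is linear in the affected tour and its set of non-tree edges, and
-- the tour has at most 3f + 1 nodes if the tree has f edges. Summing the bounds `deleteEdge_spec`
-- and `insertEdge_spec` over the edges, and adding O(|V|) for isolated vertices and for `rebuild`,
-- gives both update bounds.

universe w

namespace DynCC

/-! ### Values and step counts of composed computations. -/

namespace Timed

variable {β γ : Type w}

@[simp] theorem bind_val (x : Timed β) (f : β → Timed γ) : (x >>= f).val = (f x.val).val := rfl

@[simp] theorem bind_time (x : Timed β) (f : β → Timed γ) :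
    (x >>= f).time = x.time + (f x.val).time := rfl

@[simp] theorem pure_val (b : β) : (pure b : Timed β).val = b := rfl

@[simp] theorem pure_time (b : β) : (pure b : Timed β).time = 0 := rfl

@[simp] theorem steps_val (n : ℕ) (b : β) : (steps n b).val = b := rfl

@[simp] theorem steps_time (n : ℕ) (b : β) : (steps n b).time = n := rfl

@[simp] theorem step_val (b : β) : (step b).val = b := rfl

@[simp] theorem step_time (b : β) : (step b).time = 1 := rfl

@[simp] theorem tick_time : tick.time = 1 := rfl

end Timed

/-! ### Splay trees: zippers, in-order sequences, and the access lemma. -/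

namespace SplayTree

variable {κ : Type*}

theorem size_eq_length (t : SplayTree κ) : t.size = t.toList.length := by
  induction t with
  | nil => rfl
  | node l x r hl hr => simp only [size, toList, List.length_append, List.length_cons]; omega

@[simp] theorem toList_single (x : κ) : (single x).toList = [x] := rfl

theorem eq_nil_of_toList {t : SplayTree κ} (h : t.toList = []) : t = nil := by
  cases t with
  | nil => rfl
  | node l x r => simp [toList] at h

/-- The tree with subtree `t` below the given ancestors. -/
def plug : SplayTree κ → List (Frame κ) → SplayTree κ
  | t, [] => t
  | t, Frame.left p c :: fs => plug (node t p c) fs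
  | t, Frame.right a p :: fs => plug (node a p t) fs

theorem toList_plug_congr {s t : SplayTree κ} (h : s.toList = t.toList) (fs : List (Frame κ)) :
    (plug s fs).toList = (plug t fs).toList := by
  induction fs generalizing s t with
  | nil => exact h
  | cons f fs ih => cases f <;> exact ih (by simp [toList, h])

/-- Each ancestor contributes at least its own node. Hence depth is at most size, which gives the
worst-case times. -/
theorem size_plug (t : SplayTree κ) (fs : List (Frame κ)) :
    t.size + fs.length ≤ (plug t fs).size := by
  induction fs generalizing t with
  | nil => exact le_rfl
  | cons f fs ih =>
    cases f with
    | left p c =>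
      have := ih (node t p c)
      simp only [plug, size, List.length_cons] at *; omega
    | right a p =>
      have := ih (node a p t)
      simp only [plug, size, List.length_cons] at *; omega

section Locate

variable [DecidableEq κ]

theorem locate_eq_none {x : κ} {t : SplayTree κ} (h : x ∉ t.toList) (fs : List (Frame κ)) :
    locate x t fs = none := by
  induction t generalizing fs with
  | nil => rfl
  | node l k r hl hr =>
    simp only [toList, List.mem_append, List.mem_cons, not_or] at h
    simp [locate, Ne.symm h.2.1, hl h.1, hr h.2.2]

/-- `plug` undoes the descent of `locate`, so that splaying can be analysed by induction on the list
of ancestors. -/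
theorem exists_locate {x : κ} {t : SplayTree κ} (h : x ∈ t.toList) (fs : List (Frame κ)) :
    ∃ l r gs, locate x t fs = some (l, r, gs) ∧ plug (node l x r) gs = plug t fs := by
  induction t generalizing fs with
  | nil => simp [toList] at h
  | node l k r hl hr =>
    by_cases hk : k = x
    · subst hk
      exact ⟨l, r, fs, by simp [locate], rfl⟩
    by_cases hxl : x ∈ l.toList
    · obtain ⟨l', r', gs, h₁, h₂⟩ := hl hxl (Frame.left k r :: fs)
      exact ⟨l', r', gs, by simp [locate, hk, h₁], h₂⟩
    · have hxr : x ∈ r.toList := by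
        simp only [toList, List.mem_append, List.mem_cons] at h
        rcases h with h | h | h
        · exact absurd h hxl
        · exact absurd h.symm hk
        · exact h
      obtain ⟨l', r', gs, h₁, h₂⟩ := hr hxr (Frame.right l k :: fs)
      exact ⟨l', r', gs, by simp [locate, hk, locate_eq_none hxl, h₁], h₂⟩

end Locate

theorem splayUp_time (l r : SplayTree κ) (fs : List (Frame κ)) :
    (splayUp l r fs).time = fs.length + 1 := by
  induction l, r, fs using splayUp.induct <;> simp_all [splayUp] <;> omega

/-- Every rotation preserves the in-order sequence of the subtree on which it acts, and the
ancestors see only that sequence. -/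
theorem splayUp_toList (x : κ) (l r : SplayTree κ) (fs : List (Frame κ)) :
    (splayUp l r fs).val.1.toList ++ x :: (splayUp l r fs).val.2.toList =
      (plug (node l x r) fs).toList := by
  induction l, r, fs using splayUp.induct with
  | case1 => rfl
  | case2 => simp [splayUp, plug, toList]
  | case3 => simp [splayUp, plug, toList]
  | case4 l r p c g d fs ih =>
    exact (ih (l, node r p (node c g d))).trans (toList_plug_congr (by simp [toList]) fs)
  | case5 l r a p b g fs ih =>
    exact (ih (node (node b g a) p l, r)).trans (toList_plug_congr (by simp [toList]) fs)
  | case6 l r p c b g fs ih =>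
    exact (ih (node b g l, node r p c)).trans (toList_plug_congr (by simp [toList]) fs)
  | case7 l r a p g d fs ih =>
    exact (ih (node a p l, node r g d)).trans (toList_plug_congr (by simp [toList]) fs)

/-- The sum of the logarithms of the sizes of all subtrees. -/
noncomputable def logSum : SplayTree κ → ℝ
  | nil => 0
  | node l x r => l.logSum + r.logSum + Real.log (node l x r).size

theorem logSum_nonneg (t : SplayTree κ) : 0 ≤ t.logSum := by
  induction t with
  | nil => exact le_rfl
  | node l x r hl hr => exact add_nonneg (add_nonneg hl hr) (Real.log_natCast_nonneg _)

theorem logSum_le (t : SplayTree κ) : t.logSum ≤ t.size * Real.log t.size := by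
  -- The logarithm is decoupled from the tree: with a fixed n the bound passes additively from the
  -- subtrees to the node.
  suffices ∀ n : ℕ, t.size ≤ n → t.logSum ≤ t.size * Real.log n from this _ le_rfl
  intro n hn
  induction t with
  | nil => simp [logSum, size]
  | node l x r hl hr =>
    have h := Real.log_le_log (by simp [size]; positivity) (Nat.cast_le (α := ℝ).2 hn)
    simp only [size] at hn
    have := hl (by omega)
    have := hr (by omega)
    simp only [logSum]
    have e : ((node l x r).size : ℝ) = l.size + r.size + 1 := by simp [size]
    rw [e] at h ⊢
    nlinarith

theorem size_plug_congr {s t : SplayTree κ} (h : s.size = t.size) (fs : List (Frame κ)) :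
    (plug s fs).size = (plug t fs).size := by
  induction fs generalizing s t with
  | nil => exact h
  | cons f fs ih => cases f <;> exact ih (by simp [size, h])

/-- The ancestors depend on a subtree only through its size, so the change of the sum is local to
the rotation. -/
theorem logSum_plug_congr {s t : SplayTree κ} (h : s.size = t.size) (fs : List (Frame κ)) :
    (plug s fs).logSum + t.logSum = (plug t fs).logSum + s.logSum := by
  induction fs generalizing s t with
  | nil => simp [plug, add_comm]
  | cons f fs ih =>
    cases f with
    | left p c =>
      have := ih (s := node s p c) (t := node t p c) (by simp [size, h])
      simp only [plug, logSum, size, h] at *; linarith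
    | right a p =>
      have := ih (s := node a p s) (t := node a p t) (by simp [size, h])
      simp only [plug, logSum, size, h] at *; linarith

/-- This is 4ab ≤ (a + b)² ≤ c². The gain 2 log 2 pays for the two levels that a double rotation
climbs. -/
theorem log_add_log_le {a b c : ℕ} (ha : 0 < a) (hb : 0 < b) (h : a + b ≤ c) :
    Real.log a + Real.log b + 2 * Real.log 2 ≤ 2 * Real.log c := by
  have ha' : (0 : ℝ) < a := by exact_mod_cast ha
  have hb' : (0 : ℝ) < b := by exact_mod_cast hb
  have h' : (a : ℝ) + b ≤ c := by exact_mod_cast h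
  have e₁ : Real.log a + Real.log b + 2 * Real.log 2 = Real.log (a * b * 2 ^ 2) := by
    rw [Real.log_mul (by positivity) (by positivity), Real.log_mul ha'.ne' hb'.ne', Real.log_pow]
    norm_num
  have e₂ : 2 * Real.log c = Real.log ((c : ℝ) ^ 2) := by rw [Real.log_pow]; norm_num
  rw [e₁, e₂]
  apply Real.log_le_log (by positivity)
  nlinarith [sq_nonneg ((a : ℝ) - b)]

theorem log_natCast_mono {a b : ℕ} (h : a ≤ b) : Real.log a ≤ Real.log b := by
  rcases Nat.eq_zero_or_pos a with rfl | ha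
  · simpa using Real.log_natCast_nonneg b
  · exact Real.log_le_log (by exact_mod_cast ha) (by exact_mod_cast h)

/-- The access lemma for a double rotation at the bottom of the path. -/
theorem logSum_double_rotation {s s₁ s₂ : SplayTree κ} {fs : List (Frame κ)} {R : ℝ} {k : ℕ}
    (hsize : s₁.size = s₂.size)
    (hstep : s₁.logSum + 2 * Real.log 2 ≤
      s₂.logSum + 3 * (Real.log s₂.size - Real.log s.size))
    (ih : R + Real.log 2 * k ≤ (plug s₁ fs).logSum +
      3 * (Real.log (plug s₁ fs).size - Real.log s₁.size) + Real.log 2) :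
    R + Real.log 2 * (k + 2 : ℕ) ≤ (plug s₂ fs).logSum +
      3 * (Real.log (plug s₂ fs).size - Real.log s.size) + Real.log 2 := by
  have h₁ := logSum_plug_congr hsize fs
  have h₂ := size_plug_congr hsize fs
  rw [h₂, hsize] at ih
  push_cast
  linarith

/-- A double rotation keeps the size of the subtree it acts on, so the terms 3 (log − log) telescope
along the path. A single rotation occurs at most once, at the root, and is covered by the extra log
2. -/
theorem splayUp_logSum (x : κ) (l r : SplayTree κ) (fs : List (Frame κ)) :
    (node (splayUp l r fs).val.1 x (splayUp l r fs).val.2).logSum + Real.log 2 * fs.length ≤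
      (plug (node l x r) fs).logSum +
        3 * (Real.log (plug (node l x r) fs).size - Real.log (node l x r).size) + Real.log 2 := by
  have log2 : 0 ≤ Real.log 2 := Real.log_nonneg (by norm_num)
  induction l, r, fs using splayUp.induct with
  | case1 => simp [splayUp, plug, log2]
  | case2 l r p c =>
    have h₁ := log_natCast_mono (a := r.size + c.size + 1) (b := l.size + r.size + 1 + c.size + 1)
      (by omega)
    have h₂ := log_natCast_mono (a := l.size + r.size + 1) (b := l.size + r.size + 1 + c.size + 1)
      (by omega)
    have e : l.size + (r.size + c.size + 1) + 1 = l.size + r.size + 1 + c.size + 1 := by omega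
    simp only [splayUp, plug, logSum, size, Timed.steps_val, List.length_cons, List.length_nil, e]
    push_cast at *; linarith
  | case3 l r a p =>
    have h₁ := log_natCast_mono (a := a.size + l.size + 1) (b := a.size + (l.size + r.size + 1) + 1)
      (by omega)
    have h₂ := log_natCast_mono (a := l.size + r.size + 1) (b := a.size + (l.size + r.size + 1) + 1)
      (by omega)
    have e : a.size + l.size + 1 + r.size + 1 = a.size + (l.size + r.size + 1) + 1 := by omega
    simp only [splayUp, plug, logSum, size, Timed.steps_val, List.length_cons, List.length_nil, e]
    push_cast at *; linarith
  | case4 l r p c g d fs ih =>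
    refine logSum_double_rotation (s := node l x r) (s₁ := node l x (node r p (node c g d)))
      (s₂ := node (node (node l x r) p c) g d) (by simp only [size]; omega) ?_
      (ih (l, node r p (node c g d)))
    -- Zig-zig: the old subtree of the node and the new subtree of its grandparent are disjoint
    -- parts of the whole.
    have h₁ := log_add_log_le (a := l.size + r.size + 1) (b := c.size + d.size + 1)
      (c := l.size + r.size + 1 + c.size + 1 + d.size + 1) (by omega) (by omega) (by omega)
    have h₂ := log_natCast_mono (a := r.size + (c.size + d.size + 1) + 1)
      (b := l.size + r.size + 1 + c.size + 1 + d.size + 1) (by omega)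
    have h₃ := log_natCast_mono (a := l.size + r.size + 1) (b := l.size + r.size + 1 + c.size + 1)
      (by omega)
    have e : l.size + (r.size + (c.size + d.size + 1) + 1) + 1 =
      l.size + r.size + 1 + c.size + 1 + d.size + 1 := by omega
    simp only [logSum, size, e]
    linarith
  | case5 l r a p b g fs ih =>
    refine logSum_double_rotation (s := node l x r) (s₁ := node (node (node b g a) p l) x r)
      (s₂ := node b g (node a p (node l x r))) (by simp only [size]; omega) ?_
      (ih (node (node b g a) p l, r))
    have h₁ := log_add_log_le (a := l.size + r.size + 1) (b := b.size + a.size + 1)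
      (c := b.size + (a.size + (l.size + r.size + 1) + 1) + 1) (by omega) (by omega) (by omega)
    have h₂ := log_natCast_mono (a := b.size + a.size + 1 + l.size + 1)
      (b := b.size + (a.size + (l.size + r.size + 1) + 1) + 1) (by omega)
    have h₃ := log_natCast_mono (a := l.size + r.size + 1) (b := a.size + (l.size + r.size + 1) + 1)
      (by omega)
    have e : b.size + a.size + 1 + l.size + 1 + r.size + 1 =
      b.size + (a.size + (l.size + r.size + 1) + 1) + 1 := by omega
    simp only [logSum, size, e]
    linarith
  | case6 l r p c b g fs ih =>
    refine logSum_double_rotation (s := node l x r) (s₁ := node (node b g l) x (node r p c))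
      (s₂ := node b g (node (node l x r) p c)) (by simp only [size]; omega) ?_
      (ih (node b g l, node r p c))
    -- Zig-zag: here the two disjoint parts are the new subtrees of grandparent and parent.
    have h₁ := log_add_log_le (a := b.size + l.size + 1) (b := r.size + c.size + 1)
      (c := b.size + (l.size + r.size + 1 + c.size + 1) + 1) (by omega) (by omega) (by omega)
    have h₂ := log_natCast_mono (a := l.size + r.size + 1)
      (b := b.size + (l.size + r.size + 1 + c.size + 1) + 1) (by omega)
    have h₃ := log_natCast_mono (a := l.size + r.size + 1) (b := l.size + r.size + 1 + c.size + 1)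
      (by omega)
    have e : b.size + l.size + 1 + (r.size + c.size + 1) + 1 =
      b.size + (l.size + r.size + 1 + c.size + 1) + 1 := by omega
    simp only [logSum, size, e]
    linarith
  | case7 l r a p g d fs ih =>
    refine logSum_double_rotation (s := node l x r) (s₁ := node (node a p l) x (node r g d))
      (s₂ := node (node a p (node l x r)) g d) (by simp only [size]; omega) ?_
      (ih (node a p l, node r g d))
    have h₁ := log_add_log_le (a := a.size + l.size + 1) (b := r.size + d.size + 1)
      (c := a.size + (l.size + r.size + 1) + 1 + d.size + 1) (by omega) (by omega) (by omega)
    have h₂ := log_natCast_mono (a := l.size + r.size + 1)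
      (b := a.size + (l.size + r.size + 1) + 1 + d.size + 1) (by omega)
    have h₃ := log_natCast_mono (a := l.size + r.size + 1) (b := a.size + (l.size + r.size + 1) + 1)
      (by omega)
    have e : a.size + l.size + 1 + (r.size + d.size + 1) + 1 =
      a.size + (l.size + r.size + 1) + 1 + d.size + 1 := by omega
    simp only [logSum, size, e]
    linarith

/-- The potential of a splay tree. -/
noncomputable def potential (t : SplayTree κ) : ℝ := 4 * t.logSum

theorem potential_nonneg (t : SplayTree κ) : 0 ≤ t.potential :=
  mul_nonneg (by norm_num) t.logSum_nonneg

theorem potential_le (t : SplayTree κ) : t.potential ≤ 4 * (t.size * Real.log t.size) :=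
  mul_le_mul_of_nonneg_left t.logSum_le (by norm_num)

@[simp] theorem potential_nil : (nil : SplayTree κ).potential = 0 := by simp [potential, logSum]

@[simp] theorem potential_single (x : κ) : (single x).potential = 0 := by
  simp [single, potential, logSum, size]

theorem potential_node (l : SplayTree κ) (x : κ) (r : SplayTree κ) :
    (node l x r).potential =
      l.potential + r.potential + 4 * Real.log (node l x r).size := by
  simp only [potential, logSum]; ring

theorem potential_add_le (l : SplayTree κ) (x : κ) (r : SplayTree κ) :
    l.potential + r.potential ≤ (node l x r).potential := by
  rw [potential_node]
  linarith [Real.log_natCast_nonneg (node l x r).size]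

theorem lastValue_spec (x : κ) (r : SplayTree κ) :
    ∃ ys, x :: r.toList = ys ++ [(lastValue x r).val] := by
  induction r generalizing x with
  | nil => exact ⟨[], rfl⟩
  | node a y b _ ih =>
    obtain ⟨ys, h⟩ := ih y
    exact ⟨x :: a.toList ++ ys, by simp [toList, lastValue, h]⟩

/-! ### Amortized cost of splaying and of concatenation. -/

section Operations

variable [DecidableEq κ]

theorem splay_eq {x : κ} {t l r : SplayTree κ} {fs : List (Frame κ)}
    (h : locate x t [] = some (l, r, fs)) :
    (splay x t).val = (splayUp l r fs).val ∧ (splay x t).time = fs.length + 2 := by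
  simp only [splay, Timed.bind_val, Timed.bind_time, Timed.step_val, Timed.step_time, h,
    splayUp_time]
  exact ⟨trivial, by omega⟩

theorem splay_toList {x : κ} {t : SplayTree κ} (h : x ∈ t.toList) :
    (splay x t).val.1.toList ++ x :: (splay x t).val.2.toList = t.toList := by
  obtain ⟨l, r, fs, h₁, h₂⟩ := exists_locate h []
  rw [(splay_eq h₁).1, splayUp_toList, h₂, plug]

theorem splay_time_le {x : κ} {t : SplayTree κ} (h : x ∈ t.toList) :
    (splay x t).time ≤ t.size + 2 := by
  obtain ⟨l, r, fs, h₁, h₂⟩ := exists_locate h []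
  have := size_plug (node l x r) fs
  rw [h₂, plug] at this
  rw [(splay_eq h₁).2]; omega

/-- The factor 4 in `potential` is chosen so that 4 log 2 ≥ 2: every ancestor releases two units,
one for its rotation and one for the walk that precedes the splay in `concat`. The constant 3 is a
bound for 4 log 2. -/
theorem splay_potential_le {x : κ} {t l r : SplayTree κ} {fs : List (Frame κ)}
    (h : locate x t [] = some (l, r, fs)) (h' : plug (node l x r) fs = t) :
    2 * fs.length + (node (splay x t).val.1 x (splay x t).val.2).potential ≤
      t.potential + 12 * Real.log t.size + 3 := by
  have h₁ := splayUp_logSum x l r fs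
  rw [h'] at h₁
  rw [(splay_eq h).1]
  simp only [potential]
  have h₂ := Real.log_two_gt_d9
  have h₃ := Real.log_two_lt_d9
  have h₄ := Real.log_natCast_nonneg (node l x r).size
  have h₅ : (1 / 2) * (fs.length : ℝ) ≤ Real.log 2 * fs.length :=
    mul_le_mul_of_nonneg_right (by linarith) (by positivity)
  linarith

theorem splay_amortized {x : κ} {t : SplayTree κ} (h : x ∈ t.toList) :
    (splay x t).time + (node (splay x t).val.1 x (splay x t).val.2).potential ≤
      t.potential + 12 * Real.log t.size + 5 := by
  obtain ⟨l, r, fs, h₁, h₂⟩ := exists_locate h []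
  have := splay_potential_le h₁ h₂
  rw [(splay_eq h₁).2]
  push_cast
  have : (0 : ℝ) ≤ fs.length := by positivity
  linarith

/-- The walk to the last node visits that node and those of its ancestors that lie in the tree, so
its time is a depth. Distinct values are needed because `locate` identifies nodes by value and looks
to the left first. -/
theorem locate_lastValue (l : SplayTree κ) (x : κ) (r : SplayTree κ)
    (h : (node l x r).toList.Nodup) (fs : List (Frame κ)) :
    ∃ l' r' gs, locate (lastValue x r).val (node l x r) fs = some (l', r', gs) ∧
      plug (node l' (lastValue x r).val r') gs = plug (node l x r) fs ∧
      gs.length + 1 = fs.length + (lastValue x r).time := by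
  induction r generalizing l x fs with
  | nil => exact ⟨l, nil, fs, by simp [locate, lastValue], rfl, rfl⟩
  | node a y b _ ih =>
    have hn : (node a y b).toList.Nodup :=
      (List.nodup_cons.1 (List.nodup_append.1 h).2.1).2
    obtain ⟨l', r', gs, h₁, h₂, h₃⟩ := ih a y hn (Frame.right l x :: fs)
    have hmem : (lastValue y b).val ∈ (node a y b).toList := by
      obtain ⟨ys, e⟩ := lastValue_spec y b
      simp only [toList, e]; simp
    have hx : x ≠ (lastValue y b).val := fun e =>
      (List.nodup_cons.1 (List.nodup_append.1 h).2.1).1 (e ▸ hmem)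
    have hl : (lastValue y b).val ∉ l.toList := fun e =>
      (List.nodup_append.1 h).2.2 _ e _ (List.mem_cons_of_mem _ hmem) rfl
    refine ⟨l', r', gs, ?_, h₂, ?_⟩
    · simp only [lastValue, Timed.bind_val]
      rw [locate, if_neg hx, locate_eq_none hl, h₁]; rfl
    · simp only [lastValue, Timed.bind_time, Timed.tick_time, List.length_cons] at h₃ ⊢; omega

/-- Walk and splay together take 2d + 4 steps at depth d, and the splay releases 2d. The coefficient
is 16 = 12 + 4: the splay, and the root whose subtree grows by the second tree. -/
theorem concat_spec {s : SplayTree κ} (hs : s.toList.Nodup) (t : SplayTree κ) :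
    (concat s t).val.toList = s.toList ++ t.toList ∧
    (concat s t).time ≤ 2 * s.size + 4 ∧
    (concat s t).time + (concat s t).val.potential ≤
      s.potential + t.potential + 16 * Real.log (s.size + t.size : ℕ) + 7 := by
  have h₀ := Real.log_natCast_nonneg (s.size + t.size)
  cases s with
  | nil => simp [concat, toList, size] at h₀ ⊢; linarith
  | node l x r =>
    cases t with
    | nil => simp [concat, toList, size] at h₀ ⊢; linarith
    | node a y b =>
      obtain ⟨ys, hys⟩ := lastValue_spec x r
      obtain ⟨l', r', gs, h₁, h₂, h₃⟩ := locate_lastValue l x r hs []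
      have hpot := splay_potential_le h₁ h₂
      have hlen := size_plug (node l' (lastValue x r).val r') gs
      rw [h₂, plug] at hlen
      have hmem : (lastValue x r).val ∈ (node l x r).toList := by
        simp only [toList, hys]; simp
      have htl := splay_toList hmem
      have htime := (splay_eq h₁).2
      set z := splay (lastValue x r).val (node l x r) with hz
      -- Nothing is lost when the right subtree is replaced: if it were nonempty, its last value
      -- would again be the last value of the sequence, contradicting distinctness.
      have hnil : z.val.2 = nil := by
        apply eq_nil_of_toList
        have e : (node l x r).toList = (l.toList ++ ys) ++ [(lastValue x r).val] := by
          simp only [toList, hys]; simp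
        rw [e] at htl hs
        have hn := htl ▸ hs
        by_contra hne
        have h₅ := congrArg List.getLast? htl
        rw [List.getLast?_append, List.getLast?_cons, List.getLast?_concat] at h₅
        simp only [Option.some_or, Option.some.injEq] at h₅
        obtain ⟨w, hw⟩ := Option.ne_none_iff_exists'.1 (mt List.getLast?_eq_none_iff.1 hne)
        rw [hw] at h₅
        simp at h₅
        subst h₅
        exact (List.nodup_cons.1 (List.nodup_append.1 hn).2.1).1 (List.mem_of_getLast? hw)
      have hcv : (concat (node l x r) (node a y b)).val =
          node z.val.1 (lastValue x r).val (node a y b) := rfl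
      have hct : (concat (node l x r) (node a y b)).time =
          (lastValue x r).time + (z.time + 1) := rfl
      rw [hcv, hct]
      rw [hnil] at htl hpot
      have hsz := congrArg List.length htl
      rw [List.length_append, ← size_eq_length, ← size_eq_length] at hsz
      simp only [toList, List.length_cons, List.length_nil] at hsz
      refine ⟨?_, ?_, ?_⟩
      · rw [← htl]; simp [toList]
      · have h₄ : 1 ≤ (node l' (lastValue x r).val r').size := by simp [size]
        simp only [List.length_nil] at h₃
        omega
      · rw [potential_node] at hpot ⊢
        have e : (node z.val.1 (lastValue x r).val (node a y b)).size =
          (node l x r).size + (node a y b).size := by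
          rw [← hsz]; simp only [size]; omega
        have h₆ := log_natCast_mono (a := (node l x r).size)
          (b := (node l x r).size + (node a y b).size) (by omega)
        have h₇ := Real.log_natCast_nonneg (node z.val.1 (lastValue x r).val nil).size
        rw [e]
        have h₈ : ((lastValue x r).time + (z.time + 1) : ℕ) = 2 * gs.length + 4 := by
          simp only [List.length_nil] at h₃; omega
        rw [h₈]
        simp only [potential_nil] at hpot
        push_cast at *
        linarith

end Operations

end SplayTree

open TourNode SplayTree

/-! ### Euler tours as closed walks; joining and splitting them. -/

section Tours

variable {α : Type*}

/-- The list of tour nodes is a walk from `a` to `b`. -/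
def Traverse : α → List (TourNode α) → α → Prop
  | a, [], b => a = b
  | a, n :: l, b => n.source = a ∧ Traverse n.target l b

theorem traverse_append {a b : α} {l m : List (TourNode α)} :
    Traverse a (l ++ m) b ↔ ∃ c, Traverse a l c ∧ Traverse c m b := by
  induction l generalizing a with
  | nil => simp [Traverse]
  | cons n l ih => simp [Traverse, ih, and_assoc]

theorem traverse_cons_iff {n : TourNode α} {l : List (TourNode α)} {b : α} :
    Traverse n.source (n :: l) b ↔
      (n :: l).IsChain (fun x y => x.target = y.source) ∧
        ∀ x ∈ (n :: l).getLast?, x.target = b := by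
  induction l generalizing n with
  | nil => simp [Traverse]
  | cons m l ih =>
    rw [List.isChain_cons_cons, List.getLast?_cons_cons, and_assoc, ← ih]
    simp only [Traverse, true_and]
    constructor
    · rintro ⟨h₁, h₂⟩; exact ⟨h₁.symm, h₂⟩
    · rintro ⟨h₁, h₂⟩; exact ⟨h₁.symm, h₂⟩

/-- A walk with named ends splits along `++` (`traverse_append`), which makes rotating and cutting
tours a formality; the chain form in `IsEulerTour` does not split so directly. -/
theorem closed_iff_traverse {l : List (TourNode α)} (h : l ≠ []) :
    (l.IsChain (fun x y => x.target = y.source) ∧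
      ∀ a ∈ l.getLast?, ∀ b ∈ l.head?, a.target = b.source) ↔ ∃ a, Traverse a l a := by
  cases l with
  | nil => exact absurd rfl h
  | cons n l =>
    constructor
    · rintro ⟨h₁, h₂⟩
      exact ⟨n.source, traverse_cons_iff.2 ⟨h₁, fun x hx => h₂ x hx n rfl⟩⟩
    · rintro ⟨a, ha⟩
      have : n.source = a := ha.1
      subst this
      obtain ⟨h₁, h₂⟩ := traverse_cons_iff.1 ha
      refine ⟨h₁, fun x hx y hy => ?_⟩
      simp only [List.head?_cons, Option.mem_def, Option.some.injEq] at hy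
      exact hy ▸ h₂ x hx

theorem traverse_mem {W : Finset α} {a b : α} {l : List (TourNode α)} (h : Traverse a l b)
    (ha : a ∈ W) (hl : ∀ n ∈ l, n.target ∈ W) : b ∈ W := by
  induction l generalizing a with
  | nil => exact h ▸ ha
  | cons n l ih => exact ih h.2 (hl n (by simp)) fun m hm => hl m (by simp [hm])

open SimpleGraph in
theorem traverse_reachable {F : Finset (Sym2 α)} {a b : α} {l : List (TourNode α)}
    (h : Traverse a l b) (hl : ∀ x y, arc x y ∈ l → s(x, y) ∈ F) :
    (fromEdgeSet (F : Set (Sym2 α))).Reachable a b ∧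
      ∀ n ∈ l, (fromEdgeSet (F : Set (Sym2 α))).Reachable a n.source ∧
        (fromEdgeSet (F : Set (Sym2 α))).Reachable a n.target := by
  induction l generalizing a with
  | nil => exact ⟨h ▸ Reachable.refl _, by simp⟩
  | cons n l ih =>
    obtain ⟨rfl, h⟩ := h
    have hn : (fromEdgeSet (F : Set (Sym2 α))).Reachable n.source n.target := by
      cases n with
      | vtx v => exact Reachable.refl _
      | arc x y =>
        by_cases e : x = y
        · exact e ▸ Reachable.refl _
        · exact Adj.reachable ⟨hl x y (by simp), e⟩
    obtain ⟨h₁, h₂⟩ := ih h fun x y hxy => hl x y (by simp [hxy])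
    refine ⟨hn.trans h₁, fun m hm => ?_⟩
    rcases List.mem_cons.1 hm with rfl | hm
    · exact ⟨Reachable.refl _, hn⟩
    · exact ⟨hn.trans (h₂ m hm).1, hn.trans (h₂ m hm).2⟩

-- All edges of `F` have their ends in `W`, so a path that starts in `W` never leaves it.
open SimpleGraph in
theorem connected_induce {F : Finset (Sym2 α)} {W : Finset α} {a : α}
    (hF : ∀ e ∈ F, ∀ v ∈ e, v ∈ W) (ha : a ∈ W)
    (hW : ∀ b ∈ W, (fromEdgeSet (F : Set (Sym2 α))).Reachable a b) :
    ((fromEdgeSet (F : Set (Sym2 α))).induce (W : Set α)).Connected := by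
  have key : ∀ x y (hx : x ∈ W) (hy : y ∈ W), (fromEdgeSet (F : Set (Sym2 α))).Reachable x y →
      ((fromEdgeSet (F : Set (Sym2 α))).induce (W : Set α)).Reachable ⟨x, hx⟩ ⟨y, hy⟩ := by
    rintro x y hx hy ⟨p⟩
    induction p with
    | nil => exact Reachable.refl _
    | @cons x z y h p ih =>
      have hz : z ∈ W := hF _ h.1 z (by simp)
      exact (Adj.reachable (G := (fromEdgeSet (F : Set (Sym2 α))).induce (W : Set α))
        (u := ⟨x, hx⟩) (v := ⟨z, hz⟩) h).trans (ih hz hy)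
  exact
    { preconnected := fun x y => (key a x ha x.2 (hW x x.2)).symm.trans (key a y ha y.2 (hW y y.2))
      nonempty := ⟨⟨a, ha⟩⟩ }

open SimpleGraph in
theorem card_edgeSet_induce {F : Finset (Sym2 α)} {W : Finset α}
    (hF : ∀ e ∈ F, ¬ e.IsDiag ∧ ∀ v ∈ e, v ∈ W) :
    Nat.card ((fromEdgeSet (F : Set (Sym2 α))).induce (W : Set α)).edgeSet = F.card := by
  rw [Nat.card_coe_set_eq,
    ← Set.ncard_image_of_injective _ (Sym2.map.injective Subtype.val_injective),
    ← Set.ncard_coe_finset]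
  congr 1
  ext e
  constructor
  · rintro ⟨d, hd, rfl⟩
    induction d using Sym2.ind with
    | _ x y => exact hd.1
  · intro he
    induction e using Sym2.ind with
    | _ x y =>
      obtain ⟨h₁, h₂⟩ := hF _ he
      exact ⟨s(⟨x, h₂ x (by simp)⟩, ⟨y, h₂ y (by simp)⟩), ⟨he, h₁⟩, rfl⟩

-- A connected graph on `W` has at least |W| − 1 edges. This shows both that a tree edge is a bridge
-- and that the halves of a cut tree are trees.
open SimpleGraph in
theorem card_le_of_reachable {F : Finset (Sym2 α)} {W : Finset α} {a : α}
    (hF : ∀ e ∈ F, ¬ e.IsDiag ∧ ∀ v ∈ e, v ∈ W) (ha : a ∈ W)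
    (hW : ∀ b ∈ W, (fromEdgeSet (F : Set (Sym2 α))).Reachable a b) : W.card ≤ F.card + 1 := by
  have := (connected_induce (fun e he => (hF e he).2) ha hW).card_vert_le_card_edgeSet_add_one
  rw [card_edgeSet_induce hF] at this
  simpa using this

open SimpleGraph in
/-- Connectedness is implied by the walk, so that the tree condition reduces to a count. -/
theorem isEulerTour_iff {l : List (TourNode α)} {W : Finset α} {F : Finset (Sym2 α)} :
    IsEulerTour l W F ↔ (∀ e ∈ F, ¬ e.IsDiag ∧ ∀ v ∈ e, v ∈ W) ∧ l.Nodup ∧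
      (∀ v, vtx v ∈ l ↔ v ∈ W) ∧ (∀ u v, arc u v ∈ l ↔ s(u, v) ∈ F) ∧
      (∃ a ∈ W, Traverse a l a) ∧ F.card + 1 = W.card := by
  constructor
  · intro h
    have hconn := isTree_iff_connected_and_card.1 h.isTree
    obtain ⟨⟨w, hw⟩⟩ := hconn.1.nonempty
    have hw' := (h.vtx_mem w).2 hw
    obtain ⟨a, ha⟩ := (closed_iff_traverse (List.ne_nil_of_mem hw')).1 ⟨h.walk, h.closed⟩
    refine ⟨h.edge_mem, h.nodup, h.vtx_mem, h.arc_mem, ⟨a, ?_, ha⟩, ?_⟩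
    · cases l with
      | nil => simp at hw'
      | cons n l =>
        obtain ⟨rfl, -⟩ := ha
        cases n with
        | vtx v => exact (h.vtx_mem v).1 (by simp)
        | arc x y => exact (h.edge_mem _ ((h.arc_mem x y).1 (by simp))).2 x (by simp)
    · have := hconn.2
      rw [card_edgeSet_induce h.edge_mem] at this
      simpa using this
  · rintro ⟨h₁, h₂, h₃, h₄, ⟨a, ha, ht⟩, h₆⟩
    have hne := List.ne_nil_of_mem ((h₃ a).2 ha)
    obtain ⟨h₇, h₈⟩ := (closed_iff_traverse hne).2 ⟨a, ht⟩
    refine ⟨h₁, isTree_iff_connected_and_card.2 ⟨connected_induce (fun e he => (h₁ e he).2) ha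
      fun b hb => ?_, ?_⟩, h₂, h₃, h₄, h₇, h₈⟩
    · exact ((traverse_reachable ht fun x y => (h₄ x y).1).2 _ ((h₃ b).2 hb)).1
    · rw [card_edgeSet_induce h₁]; simpa using h₆

namespace IsEulerTour

variable {l : List (TourNode α)} {W : Finset α} {F : Finset (Sym2 α)}

theorem card_eq (h : IsEulerTour l W F) : F.card + 1 = W.card :=
  (isEulerTour_iff.1 h).2.2.2.2.2

theorem target_mem (h : IsEulerTour l W F) : ∀ n ∈ l, n.target ∈ W := by
  intro n hn
  cases n with
  | vtx v => exact (h.vtx_mem v).1 hn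
  | arc x y => exact (h.edge_mem _ ((h.arc_mem x y).1 hn)).2 y (by simp)

/-- A closed walk may be started at any of its points. -/
theorem rotate {A B : List (TourNode α)} (h : IsEulerTour (A ++ B) W F) :
    IsEulerTour (B ++ A) W F := by
  have hmem : ∀ n, n ∈ B ++ A ↔ n ∈ A ++ B := by simp [or_comm]
  obtain ⟨h₁, h₂, h₃, h₄, ⟨a, ha, ht⟩, h₆⟩ := isEulerTour_iff.1 h
  obtain ⟨c, hA, hB⟩ := traverse_append.1 ht
  refine isEulerTour_iff.2 ⟨h₁, (List.perm_append_comm.nodup_iff).1 h₂, fun v => ?_, fun u v => ?_,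
    ⟨c, ?_, traverse_append.2 ⟨a, hB, hA⟩⟩, h₆⟩
  · rw [hmem, h₃]
  · rw [hmem, h₄]
  · exact traverse_mem hA ha fun n hn => h.target_mem n (by simp [hn])

theorem traverse_self {u : α} (h : IsEulerTour (vtx u :: l) W F) :
    Traverse u (vtx u :: l) u := by
  obtain ⟨-, -, -, -, ⟨a, -, ht⟩, -⟩ := isEulerTour_iff.1 h
  obtain ⟨rfl, h'⟩ := id ht
  exact ht

theorem length_le (h : IsEulerTour l W F) : l.length ≤ W.card + 2 * F.card := by
  classical
  have hsub : l.toFinset ⊆ W.image vtx ∪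
      (F.image (fun e => arc e.out.1 e.out.2) ∪ F.image (fun e => arc e.out.2 e.out.1)) := by
    intro n hn
    rw [List.mem_toFinset] at hn
    cases n with
    | vtx v => simp [(h.vtx_mem v).1 hn]
    | arc x y =>
      have hF := (h.arc_mem x y).1 hn
      -- With one direction chosen for each edge, an arc is either the chosen one or its reverse: at
      -- most two arcs per edge.
      have hout : s((s(x, y)).out.1, (s(x, y)).out.2) = s(x, y) := Quot.out_eq s(x, y)
      simp only [Finset.mem_union, Finset.mem_image]
      rcases Sym2.eq_iff.1 hout with ⟨e₁, e₂⟩ | ⟨e₁, e₂⟩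
      · exact Or.inr (Or.inl ⟨_, hF, by rw [e₁, e₂]⟩)
      · exact Or.inr (Or.inr ⟨_, hF, by rw [e₁, e₂]⟩)
  have := Finset.card_le_card hsub
  rw [List.toFinset_card_of_nodup h.nodup] at this
  have h₁ := Finset.card_union_le (W.image vtx)
    (F.image (fun e => arc e.out.1 e.out.2) ∪ F.image (fun e => arc e.out.2 e.out.1))
  have h₂ := Finset.card_union_le (F.image fun e => arc e.out.1 e.out.2)
    (F.image fun e => arc e.out.2 e.out.1)
  have h₃ := Finset.card_image_le (s := W) (f := (vtx : α → TourNode α))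
  have h₄ := Finset.card_image_le (s := F) (f := fun e => arc e.out.1 e.out.2)
  have h₅ := Finset.card_image_le (s := F) (f := fun e => arc e.out.2 e.out.1)
  omega

end IsEulerTour

variable [DecidableEq α]

/-- Go round the first tour from `u` to `u`, cross to `v`, go round the second, and cross back. The
number of edges is (|W₁| − 1) + (|W₂| − 1) + 1, as a tree on the union requires. -/
theorem IsEulerTour.join {l₁ l₂ : List (TourNode α)} {W₁ W₂ : Finset α} {F₁ F₂ : Finset (Sym2 α)}
    {u v : α} (h₁ : IsEulerTour (vtx u :: l₁) W₁ F₁) (h₂ : IsEulerTour (vtx v :: l₂) W₂ F₂)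
    (hW : Disjoint W₁ W₂) :
    IsEulerTour (((vtx u :: l₁ ++ [arc u v]) ++ (vtx v :: l₂)) ++ [arc v u]) (W₁ ∪ W₂)
      (insert s(u, v) (F₁ ∪ F₂)) := by
  have hu : u ∈ W₁ := (h₁.vtx_mem u).1 (by simp)
  have hv : v ∈ W₂ := (h₂.vtx_mem v).1 (by simp)
  have hd : ∀ x ∈ W₁, x ∉ W₂ := fun _ hx => Finset.disjoint_left.1 hW hx
  have hne : u ≠ v := fun e => hd u hu (e ▸ hv)
  have t₁ := h₁.traverse_self
  have t₂ := h₂.traverse_self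
  have e₁ : ∀ x y, arc x y ∈ vtx u :: l₁ → x ∈ W₁ ∧ y ∈ W₁ := fun x y h =>
    have := (h₁.edge_mem _ ((h₁.arc_mem x y).1 h)).2
    ⟨this x (by simp), this y (by simp)⟩
  have e₂ : ∀ x y, arc x y ∈ vtx v :: l₂ → x ∈ W₂ ∧ y ∈ W₂ := fun x y h =>
    have := (h₂.edge_mem _ ((h₂.arc_mem x y).1 h)).2
    ⟨this x (by simp), this y (by simp)⟩
  have n₁ : s(u, v) ∉ F₁ := fun h => hd v ((h₁.edge_mem _ h).2 v (by simp)) hv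
  have n₂ : s(u, v) ∉ F₂ := fun h => hd u hu ((h₂.edge_mem _ h).2 u (by simp))
  have n₃ : Disjoint F₁ F₂ := Finset.disjoint_left.2 fun e h h' => by
    induction e using Sym2.ind with
    | _ x y => exact hd x ((h₁.edge_mem _ h).2 x (by simp)) ((h₂.edge_mem _ h').2 x (by simp))
  generalize vtx u :: l₁ = s at *
  generalize vtx v :: l₂ = t at *
  refine isEulerTour_iff.2 ⟨?_, ?_, ?_, ?_, ⟨u, by simp [hu], ?_⟩, ?_⟩
  · intro e he
    rcases Finset.mem_insert.1 he with rfl | he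
    · refine ⟨by simpa using hne, fun w hw => ?_⟩
      rcases Sym2.mem_iff.1 hw with rfl | rfl <;> simp [hu, hv]
    · rcases Finset.mem_union.1 he with he | he
      · exact ⟨(h₁.edge_mem e he).1, fun w hw => by simp [(h₁.edge_mem e he).2 w hw]⟩
      · exact ⟨(h₂.edge_mem e he).1, fun w hw => by simp [(h₂.edge_mem e he).2 w hw]⟩
  · have a₁ : arc u v ∉ s := fun h => n₁ ((h₁.arc_mem u v).1 h)
    have a₂ : arc u v ∉ t := fun h => n₂ ((h₂.arc_mem u v).1 h)
    have a₃ : arc v u ∉ s := fun h => n₁ (Sym2.eq_swap ▸ (h₁.arc_mem v u).1 h)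
    have a₄ : arc v u ∉ t := fun h => n₂ (Sym2.eq_swap ▸ (h₂.arc_mem v u).1 h)
    have hst : ∀ n ∈ s, n ∉ t := by
      intro n hs ht
      cases n with
      | vtx x => exact hd x ((h₁.vtx_mem x).1 hs) ((h₂.vtx_mem x).1 ht)
      | arc x y => exact hd x (e₁ x y hs).1 (e₂ x y ht).1
    have ns := h₁.nodup
    have nt := h₂.nodup
    simp only [List.nodup_append, List.mem_append, List.mem_singleton, List.nodup_singleton]
    refine ⟨⟨⟨ns, trivial, ?_⟩, nt, ?_⟩, trivial, ?_⟩
    · rintro a ha b rfl rfl; exact a₁ ha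
    · rintro a (ha | rfl) b hb rfl
      · exact hst a ha hb
      · exact a₂ hb
    · rintro a ((ha | rfl) | ha) b rfl e
      · exact a₃ (e ▸ ha)
      · exact hne (by injection e)
      · exact a₄ (e ▸ ha)
  · intro w
    simp [h₁.vtx_mem, h₂.vtx_mem]
  · intro x y
    simp only [List.mem_append, List.mem_singleton, h₁.arc_mem, h₂.arc_mem, Finset.mem_insert,
      Finset.mem_union, arc.injEq, Sym2.eq_iff]
    tauto
  · exact traverse_append.2 ⟨v, traverse_append.2 ⟨v, traverse_append.2 ⟨u, t₁, rfl, rfl⟩, t₂⟩,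
      rfl, rfl⟩
  · rw [Finset.card_insert_of_notMem (by simp [n₁, n₂]), Finset.card_union_of_disjoint n₃,
      Finset.card_union_of_disjoint hW]
    have := h₁.card_eq
    have := h₂.card_eq
    omega

/-- The vertices that are marked in a list of tour nodes. -/
def tourVerts (l : List (TourNode α)) : Finset α :=
  (l.filterMap fun n => match n with | vtx v => some v | arc _ _ => none).toFinset

/-- The edges that occur in a list of tour nodes. -/
def tourEdges (l : List (TourNode α)) : Finset (Sym2 α) := (l.filterMap edge?).toFinset

theorem mem_tourVerts {l : List (TourNode α)} {v : α} : v ∈ tourVerts l ↔ vtx v ∈ l := by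
  simp only [tourVerts, List.mem_toFinset, List.mem_filterMap]
  constructor
  · rintro ⟨n, hn, h⟩
    cases n with
    | vtx w => simp only [Option.some.injEq] at h; exact h ▸ hn
    | arc x y => simp at h
  · exact fun h => ⟨_, h, rfl⟩

theorem mem_tourEdges {l : List (TourNode α)} {e : Sym2 α} :
    e ∈ tourEdges l ↔ ∃ x y, arc x y ∈ l ∧ s(x, y) = e := by
  simp only [tourEdges, List.mem_toFinset, List.mem_filterMap]
  constructor
  · rintro ⟨n, hn, h⟩
    cases n with
    | vtx w => simp [edge?] at h
    | arc x y => simp only [edge?, Option.some.injEq] at h; exact ⟨x, y, hn, h⟩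
  · rintro ⟨x, y, h, rfl⟩
    exact ⟨_, h, rfl⟩

theorem IsEulerTour.verts_eq {l : List (TourNode α)} {W : Finset α} {F : Finset (Sym2 α)}
    (h : IsEulerTour l W F) : W = tourVerts l := by
  ext v; rw [mem_tourVerts, h.vtx_mem]

theorem IsEulerTour.edges_eq {l : List (TourNode α)} {W : Finset α} {F : Finset (Sym2 α)}
    (h : IsEulerTour l W F) : F = tourEdges l := by
  ext e
  rw [mem_tourEdges]
  constructor
  · intro he
    induction e using Sym2.ind with
    | _ x y => exact ⟨x, y, (h.arc_mem x y).2 he, rfl⟩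
  · rintro ⟨x, y, hxy, rfl⟩
    exact (h.arc_mem x y).1 hxy

-- Between the two arcs of the edge lies a closed walk `P` at `v`, and the rest `Q`, read
-- cyclically, is a closed walk at `u`. As the edge is a bridge, the two walks share no vertex, so
-- each contains the marks and both arcs of everything it touches; a count then shows that both are
-- trees.
open SimpleGraph in
theorem IsEulerTour.split {P Q : List (TourNode α)} {W : Finset α} {F : Finset (Sym2 α)} {u v : α}
    (h : IsEulerTour (arc u v :: P ++ arc v u :: Q) W F) :
    IsEulerTour P (tourVerts P) (tourEdges P) ∧ IsEulerTour Q (tourVerts Q) (tourEdges Q) ∧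
      v ∈ tourVerts P ∧ u ∈ tourVerts Q ∧ Disjoint (tourVerts Q) (tourVerts P) ∧
      tourVerts Q ∪ tourVerts P = W ∧ tourEdges Q ∪ tourEdges P = F.erase s(u, v) := by
  obtain ⟨h₁, h₂, h₃, h₄, ⟨a, ha, ht⟩, h₆⟩ := isEulerTour_iff.1 h
  have heF : s(u, v) ∈ F := (h₄ u v).1 (by simp)
  have huW := (h₁ _ heF).2 u (by simp)
  have hvW := (h₁ _ heF).2 v (by simp)
  have hne : u ≠ v := by simpa using (h₁ _ heF).1
  obtain ⟨c, ⟨h₇, hP⟩, h₈, hQ⟩ := traverse_append.1 ht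
  simp only [source, target] at h₇ h₈ hP hQ
  subst h₇ h₈
  simp only [List.cons_append, List.nodup_cons, List.mem_append, List.mem_cons, not_or,
    List.nodup_append] at h₂
  obtain ⟨⟨na, -, nb⟩, nP, ⟨nc, nQ⟩, nd⟩ := h₂
  have mem : ∀ n, n ∈ arc u v :: P ++ arc v u :: Q ↔
      n = arc u v ∨ n = arc v u ∨ n ∈ P ∨ n ∈ Q := by
    intro n; simp only [List.cons_append, List.mem_append, List.mem_cons]; tauto
  have hPu : arc v u ∉ P := fun hh => nd _ hh _ (Or.inl rfl) rfl
  have hPQ : ∀ n ∈ P, n ∉ Q := fun n hp hq => nd n hp n (Or.inr hq) rfl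
  have hmemP : ∀ x y, arc x y ∈ P → s(x, y) ∈ F.erase s(u, v) := by
    intro x y hxy
    refine Finset.mem_erase.2 ⟨fun e => ?_, (h₄ x y).1 ((mem _).2 (Or.inr (Or.inr (Or.inl hxy))))⟩
    rcases Sym2.eq_iff.1 e with ⟨rfl, rfl⟩ | ⟨rfl, rfl⟩
    · exact na hxy
    · exact hPu hxy
  have hmemQ : ∀ x y, arc x y ∈ Q → s(x, y) ∈ F.erase s(u, v) := by
    intro x y hxy
    refine Finset.mem_erase.2 ⟨fun e => ?_, (h₄ x y).1 ((mem _).2 (Or.inr (Or.inr (Or.inr hxy))))⟩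
    rcases Sym2.eq_iff.1 e with ⟨rfl, rfl⟩ | ⟨rfl, rfl⟩
    · exact nb hxy
    · exact nc hxy
  have hvtx : ∀ x ∈ W, vtx x ∈ P ∨ vtx x ∈ Q := by
    intro x hx
    rcases (mem _).1 ((h₃ x).2 hx) with e | e | e | e
    · cases e
    · cases e
    · exact Or.inl e
    · exact Or.inr e
  have harc : ∀ x y, s(x, y) ∈ F.erase s(u, v) → arc x y ∈ P ∨ arc x y ∈ Q := by
    intro x y hxy
    obtain ⟨hxy', hxyF⟩ := Finset.mem_erase.1 hxy
    rcases (mem _).1 ((h₄ x y).2 hxyF) with e | e | e | e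
    · injection e with e₁ e₂; exact absurd (by rw [e₁, e₂]) hxy'
    · injection e with e₁ e₂; exact absurd (by rw [e₁, e₂, Sym2.eq_swap]) hxy'
    · exact Or.inl e
    · exact Or.inr e
  have rP := traverse_reachable hP hmemP
  have rQ := traverse_reachable hQ hmemQ
  -- Otherwise |F| − 1 edges would connect all |F| + 1 vertices of `W`.
  have hsep : ¬ (fromEdgeSet ((F.erase s(u, v) : Finset (Sym2 α)) : Set (Sym2 α))).Reachable u v := by
    intro huv
    have := card_le_of_reachable (F := F.erase s(u, v)) (W := W) (a := u)
      (fun e he => h₁ e (Finset.mem_of_mem_erase he)) huW fun b hb => by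
        rcases hvtx b hb with hb | hb
        · exact huv.trans (rP.2 _ hb).1
        · exact (rQ.2 _ hb).1
    rw [Finset.card_erase_of_mem heF] at this
    have := Finset.card_pos.2 ⟨_, heF⟩
    omega
  -- A common end of a node of `P` and a node of `Q` would be reachable from both `v` and `u`.
  have hsep' : ∀ n ∈ P, ∀ m ∈ Q, n.source ≠ m.source ∧ n.source ≠ m.target ∧
      n.target ≠ m.source ∧ n.target ≠ m.target := by
    intro n hn m hm
    have p := rP.2 n hn
    have q := rQ.2 m hm
    refine ⟨fun e => hsep ?_, fun e => hsep ?_, fun e => hsep ?_, fun e => hsep ?_⟩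
    · exact q.1.trans (e ▸ p.1.symm)
    · exact q.2.trans (e ▸ p.1.symm)
    · exact q.1.trans (e ▸ p.2.symm)
    · exact q.2.trans (e ▸ p.2.symm)
  have hvP : vtx v ∈ P := (hvtx v hvW).resolve_right fun hh => hsep (rQ.2 _ hh).1
  have huQ : vtx u ∈ Q := (hvtx u huW).resolve_left fun hh => hsep (rP.2 _ hh).1.symm
  -- the ends of an edge of a part are marked in that part, and the reverse edge is there, too
  have partP : ∀ x y, arc x y ∈ P → vtx x ∈ P ∧ vtx y ∈ P ∧ arc y x ∈ P := by
    intro x y hxy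
    have hF := Finset.mem_of_mem_erase (hmemP x y hxy)
    refine ⟨(hvtx x ((h₁ _ hF).2 x (by simp))).resolve_right fun hh => (hsep' _ hxy _ hh).1 rfl,
      (hvtx y ((h₁ _ hF).2 y (by simp))).resolve_right fun hh => (hsep' _ hxy _ hh).2.2.1 rfl,
      (harc y x (Sym2.eq_swap (a := x) (b := y) ▸ hmemP x y hxy)).resolve_right fun hh => (hsep' _ hxy _ hh).2.1 rfl⟩
  have partQ : ∀ x y, arc x y ∈ Q → vtx x ∈ Q ∧ vtx y ∈ Q ∧ arc y x ∈ Q := by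
    intro x y hxy
    have hF := Finset.mem_of_mem_erase (hmemQ x y hxy)
    refine ⟨(hvtx x ((h₁ _ hF).2 x (by simp))).resolve_left fun hh => (hsep' _ hh _ hxy).1 rfl,
      (hvtx y ((h₁ _ hF).2 y (by simp))).resolve_left fun hh => (hsep' _ hh _ hxy).2.1 rfl,
      (harc y x (Sym2.eq_swap (a := x) (b := y) ▸ hmemQ x y hxy)).resolve_left fun hh => (hsep' _ hh _ hxy).2.2.1 rfl⟩
  have gen : ∀ R : List (TourNode α), (∀ x y, arc x y ∈ R → s(x, y) ∈ F.erase s(u, v)) →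
      (∀ x y, arc x y ∈ R → vtx x ∈ R ∧ vtx y ∈ R ∧ arc y x ∈ R) →
      (∀ e ∈ tourEdges R, ¬ e.IsDiag ∧ ∀ w ∈ e, w ∈ tourVerts R) ∧
      (∀ x y, arc x y ∈ R ↔ s(x, y) ∈ tourEdges R) := by
    intro R hR hR'
    refine ⟨fun e he => ?_, fun x y => ⟨fun hh => mem_tourEdges.2 ⟨x, y, hh, rfl⟩, fun hh => ?_⟩⟩
    · obtain ⟨x, y, hxy, rfl⟩ := mem_tourEdges.1 he
      refine ⟨(h₁ _ (Finset.mem_of_mem_erase (hR x y hxy))).1, fun w hw => mem_tourVerts.2 ?_⟩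
      rcases Sym2.mem_iff.1 hw with rfl | rfl
      · exact (hR' _ _ hxy).1
      · exact (hR' _ _ hxy).2.1
    · obtain ⟨x', y', hxy, e⟩ := mem_tourEdges.1 hh
      rcases Sym2.eq_iff.1 e with ⟨rfl, rfl⟩ | ⟨rfl, rfl⟩
      · exact hxy
      · exact (hR' _ _ hxy).2.2
  obtain ⟨gP₁, gP₂⟩ := gen P hmemP partP
  obtain ⟨gQ₁, gQ₂⟩ := gen Q hmemQ partQ
  have cP := card_le_of_reachable gP₁ (mem_tourVerts.2 hvP) fun b hb =>
    ((traverse_reachable hP fun x y => (gP₂ x y).1).2 _ (mem_tourVerts.1 hb)).1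
  have cQ := card_le_of_reachable gQ₁ (mem_tourVerts.2 huQ) fun b hb =>
    ((traverse_reachable hQ fun x y => (gQ₂ x y).1).2 _ (mem_tourVerts.1 hb)).1
  have dV : Disjoint (tourVerts Q) (tourVerts P) := Finset.disjoint_left.2 fun x hq hp =>
    hPQ _ (mem_tourVerts.1 hp) (mem_tourVerts.1 hq)
  have dE : Disjoint (tourEdges Q) (tourEdges P) := Finset.disjoint_left.2 fun e hq hp => by
    induction e using Sym2.ind with
    | _ x y => exact hPQ _ ((gP₂ x y).2 hp) ((gQ₂ x y).2 hq)
  have uV : tourVerts Q ∪ tourVerts P = W := by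
    ext x
    rw [Finset.mem_union, mem_tourVerts, mem_tourVerts, ← h₃, mem]
    simp [or_comm]
  have uE : tourEdges Q ∪ tourEdges P = F.erase s(u, v) := by
    ext e
    induction e using Sym2.ind with
    | _ x y =>
      rw [Finset.mem_union, ← gP₂, ← gQ₂]
      constructor
      · rintro (hh | hh)
        · exact hmemQ x y hh
        · exact hmemP x y hh
      · exact fun hh => (harc x y hh).symm
  -- The vertex counts add up to |F| + 1 and the edge counts to |F| − 1. Since each half has at most
  -- one vertex more than it has edges (`cP`, `cQ`), equality holds in both.
  have k₁ := Finset.card_union_of_disjoint dV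
  have k₂ := Finset.card_union_of_disjoint dE
  rw [uV] at k₁
  rw [uE, Finset.card_erase_of_mem heF] at k₂
  have := Finset.card_pos.2 ⟨_, heF⟩
  exact ⟨isEulerTour_iff.2 ⟨gP₁, nP, fun _ => mem_tourVerts.symm, gP₂,
      ⟨v, mem_tourVerts.2 hvP, hP⟩, by omega⟩,
    isEulerTour_iff.2 ⟨gQ₁, nQ, fun _ => mem_tourVerts.symm, gQ₂,
      ⟨u, mem_tourVerts.2 huQ, hQ⟩, by omega⟩,
    mem_tourVerts.2 hvP, mem_tourVerts.2 huQ, dV, uV, uE⟩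

end Tours

/-! ### Correctness and cost of linking, cutting and traversing Euler tours. -/

section TreeOperations

variable {α : Type*} [DecidableEq α]

/-- Splitting before `vtx u` and exchanging the two pieces is a cyclic rotation. The coefficient is
32 = 12 + 4 + 16: splay, the new root after the left subtree is detached, and concatenation. -/
theorem adjustHead_spec {u : α} {t : SplayTree (TourNode α)} (hu : vtx u ∈ t.toList)
    (hn : t.toList.Nodup) :
    (∃ A B, t.toList = B ++ vtx u :: A ∧ (adjustHead u t).val.toList = vtx u :: A ++ B) ∧
    (adjustHead u t).time ≤ 3 * t.size + 7 ∧
    (adjustHead u t).time + (adjustHead u t).val.potential ≤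
      t.potential + 32 * Real.log t.size + 13 := by
  have h₁ := splay_toList hu
  have h₂ := splay_time_le hu
  have h₃ := splay_amortized hu
  have hv : (adjustHead u t).val = (concat (node nil (vtx u) (splay (vtx u) t).val.2)
    (splay (vtx u) t).val.1).val := rfl
  have ht : (adjustHead u t).time = (splay (vtx u) t).time + (1 + (concat (node nil (vtx u)
    (splay (vtx u) t).val.2) (splay (vtx u) t).val.1).time) := rfl
  rw [hv, ht]
  generalize splay (vtx u) t = z at *
  have hn' : (node nil (vtx u) z.val.2).toList.Nodup := by
    rw [← h₁] at hn; exact (List.nodup_append.1 hn).2.1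
  obtain ⟨c₁, c₂, c₃⟩ := concat_spec hn' z.val.1
  have hs : (node nil (vtx u) z.val.2).size + z.val.1.size = t.size := by
    have := congrArg List.length h₁
    simp only [List.length_append, List.length_cons, ← size_eq_length] at this
    simp only [size]; omega
  rw [hs] at c₃
  have h₄ : (node nil (vtx u) z.val.2).potential ≤
      z.val.2.potential + 4 * Real.log t.size := by
    rw [potential_node, potential_nil]
    have := log_natCast_mono (a := (node nil (vtx u) z.val.2).size) (b := t.size) (by omega)
    linarith
  have h₅ := potential_add_le z.val.1 (vtx u) z.val.2
  refine ⟨⟨_, _, h₁.symm, c₁⟩, by omega, ?_⟩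
  push_cast
  linarith

/-- Both tours are rotated to start at the ends of the new edge, as `IsEulerTour.join` requires. The
coefficient is 112 = 2 · 32 + 3 · 16, for two rotations and three concatenations. -/
theorem link_spec {u v : α} {s t : SplayTree (TourNode α)} {W₁ W₂ : Finset α}
    {F₁ F₂ : Finset (Sym2 α)} (hs : IsEulerTour s.toList W₁ F₁) (ht : IsEulerTour t.toList W₂ F₂)
    (hW : Disjoint W₁ W₂) (hu : u ∈ W₁) (hv : v ∈ W₂) :
    IsEulerTour (link u v s t).val.toList (W₁ ∪ W₂) (insert s(u, v) (F₁ ∪ F₂)) ∧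
    (link u v s t).val.size = s.size + t.size + 2 ∧
    (link u v s t).time ≤ 9 * (s.size + t.size) + 34 ∧
    (link u v s t).time + (link u v s t).val.potential ≤
      s.potential + t.potential + 112 * Real.log (s.size + t.size + 2 : ℕ) + 49 := by
  obtain ⟨⟨A, B, a₁, a₂⟩, a₃, a₄⟩ := adjustHead_spec ((hs.vtx_mem u).2 hu) hs.nodup
  obtain ⟨⟨A', B', b₁, b₂⟩, b₃, b₄⟩ := adjustHead_spec ((ht.vtx_mem v).2 hv) ht.nodup
  have e₁ : IsEulerTour (vtx u :: (A ++ B)) W₁ F₁ := by rw [a₁] at hs; exact hs.rotate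
  have e₂ : IsEulerTour (vtx v :: (A' ++ B')) W₂ F₂ := by rw [b₁] at ht; exact ht.rotate
  have hj := e₁.join e₂ hW
  have hval : (link u v s t).val = (concat (concat (concat (adjustHead u s).val
    (single (arc u v))).val (adjustHead v t).val).val (single (arc v u))).val := rfl
  have htime : (link u v s t).time = (adjustHead u s).time + ((adjustHead v t).time + (1 + (1 +
    ((concat (adjustHead u s).val (single (arc u v))).time +
    ((concat (concat (adjustHead u s).val (single (arc u v))).val (adjustHead v t).val).time +
    (concat (concat (concat (adjustHead u s).val (single (arc u v))).val
      (adjustHead v t).val).val (single (arc v u))).time))))) := rfl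
  rw [hval, htime]
  have s₁ : (adjustHead u s).val.size = s.size := by
    rw [size_eq_length, size_eq_length, a₁, a₂]; simp; omega
  have s₂ : (adjustHead v t).val.size = t.size := by
    rw [size_eq_length, size_eq_length, b₁, b₂]; simp; omega
  generalize adjustHead u s = p at *
  generalize adjustHead v t = q at *
  have hj' : IsEulerTour (((p.val.toList ++ [arc u v]) ++ q.val.toList) ++ [arc v u]) (W₁ ∪ W₂)
    (insert s(u, v) (F₁ ∪ F₂)) := by rw [a₂, b₂]; exact hj
  have n₂ := (List.nodup_append.1 hj'.nodup).1
  have n₁ := (List.nodup_append.1 n₂).1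
  have n₀ := (List.nodup_append.1 n₁).1
  obtain ⟨c₁, c₂, c₃⟩ := concat_spec n₀ (single (arc u v))
  generalize concat p.val (single (arc u v)) = x at *
  rw [toList_single] at c₁
  obtain ⟨d₁, d₂, d₃⟩ := concat_spec (s := x.val) (by rw [c₁]; exact n₁) q.val
  generalize concat x.val q.val = y at *
  rw [c₁] at d₁
  obtain ⟨f₁, f₂, f₃⟩ := concat_spec (s := y.val) (by rw [d₁]; exact n₂) (single (arc v u))
  generalize concat y.val (single (arc v u)) = z at *
  rw [d₁, toList_single] at f₁
  have sx : x.val.size = s.size + 1 := by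
    rw [← s₁, size_eq_length, size_eq_length, c₁]; simp
  have sy : y.val.size = s.size + t.size + 1 := by
    rw [← s₁, ← s₂, size_eq_length, size_eq_length, size_eq_length, d₁]; simp; omega
  have sz : z.val.size = s.size + t.size + 2 := by
    rw [← s₁, ← s₂, size_eq_length, size_eq_length, size_eq_length, f₁]; simp; omega
  have hsingle : ∀ n : TourNode α, (single n).size = 1 := fun n => rfl
  rw [s₁] at c₂ c₃
  rw [sx, s₂] at d₃
  rw [sx] at d₂
  rw [sy, hsingle] at f₃
  rw [sy] at f₂
  rw [hsingle] at c₃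
  refine ⟨by rw [f₁]; exact hj', sz, by omega, ?_⟩
  have l₁ := log_natCast_mono (a := s.size) (b := s.size + t.size + 2) (by omega)
  have l₂ := log_natCast_mono (a := t.size) (b := s.size + t.size + 2) (by omega)
  have l₃ := log_natCast_mono (a := s.size + 1) (b := s.size + t.size + 2) (by omega)
  have l₄ := log_natCast_mono (a := s.size + 1 + t.size) (b := s.size + t.size + 2) (by omega)
  rw [show s.size + t.size + 1 + 1 = s.size + t.size + 2 from rfl] at f₃
  rw [potential_single] at c₃ f₃
  push_cast at *
  linarith

/-- Detaching `arc u v` and exchanging the two sides turns the cyclic tour into one that starts just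
after this arc; splaying `arc v u` then separates the walks of `IsEulerTour.split`. The coefficient
is 40 = 12 + 16 + 12. -/
theorem cut_spec {u v : α} {t : SplayTree (TourNode α)} {W : Finset α} {F : Finset (Sym2 α)}
    (ht : IsEulerTour t.toList W F) (huv : s(u, v) ∈ F) :
    (∃ W₁ W₂ F₁ F₂, u ∈ W₁ ∧ v ∈ W₂ ∧ Disjoint W₁ W₂ ∧ W₁ ∪ W₂ = W ∧ F₁ ∪ F₂ = F.erase s(u, v) ∧
      IsEulerTour (cut u v t).val.1.toList W₁ F₁ ∧ IsEulerTour (cut u v t).val.2.toList W₂ F₂) ∧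
    (cut u v t).val.1.size + (cut u v t).val.2.size + 2 = t.size ∧
    (cut u v t).time ≤ 4 * t.size + 10 ∧
    (cut u v t).time + (cut u v t).val.1.potential + (cut u v t).val.2.potential ≤
      t.potential + 40 * Real.log t.size + 19 := by
  have hne : u ≠ v := by simpa using (ht.edge_mem _ huv).1
  have hmem := (ht.arc_mem u v).2 huv
  have hmem' := (ht.arc_mem v u).2 (Sym2.eq_swap (a := u) (b := v) ▸ huv)
  have h₁ := splay_toList hmem
  have h₂ := splay_time_le hmem
  have h₃ := splay_amortized hmem
  have hval : (cut u v t).val =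
    ((splay (arc v u) (concat (splay (arc u v) t).val.2 (splay (arc u v) t).val.1).val).val.2,
     (splay (arc v u) (concat (splay (arc u v) t).val.2 (splay (arc u v) t).val.1).val).val.1) :=
    rfl
  have htime : (cut u v t).time = (splay (arc u v) t).time + (1 +
    ((concat (splay (arc u v) t).val.2 (splay (arc u v) t).val.1).time +
    ((splay (arc v u) (concat (splay (arc u v) t).val.2 (splay (arc u v) t).val.1).val).time +
    (1 + 0)))) := rfl
  rw [hval, htime]
  generalize splay (arc u v) t = z at *
  have hn := ht.nodup
  rw [← h₁] at hn
  obtain ⟨c₁, c₂, c₃⟩ := concat_spec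
    (List.nodup_cons.1 (List.nodup_append.1 hn).2.1).2 z.val.1
  generalize concat z.val.2 z.val.1 = n at *
  have hsz := congrArg List.length h₁
  simp only [List.length_append, List.length_cons, ← size_eq_length] at hsz
  have hsn := congrArg List.length c₁
  simp only [List.length_append, ← size_eq_length] at hsn
  have hmem'' : arc v u ∈ n.val.toList := by
    rw [← h₁] at hmem'
    rw [c₁]
    simp only [List.mem_append, List.mem_cons] at hmem' ⊢
    rcases hmem' with h | h | h
    · exact Or.inr h
    · exact absurd (by injection h) hne.symm
    · exact Or.inl h
  have d₁ := splay_toList hmem''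
  have d₂ := splay_time_le hmem''
  have d₃ := splay_amortized hmem''
  generalize splay (arc v u) n.val = w at *
  have hsw := congrArg List.length d₁
  simp only [List.length_append, List.length_cons, ← size_eq_length] at hsw
  have hE : IsEulerTour (arc u v :: w.val.1.toList ++ arc v u :: w.val.2.toList) W F := by
    have := ht
    rw [← h₁] at this
    have := this.rotate
    rw [List.cons_append, ← c₁, ← d₁] at this
    simpa using this
  obtain ⟨s₁, s₂, s₃, s₄, s₅, s₆, s₇⟩ := hE.split
  refine ⟨⟨_, _, _, _, s₄, s₃, s₅, s₆, s₇, s₂, s₁⟩, ?_, ?_, ?_⟩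
  · simp only; omega
  · omega
  · have h₄ := potential_add_le z.val.1 (arc u v) z.val.2
    have h₅ := potential_add_le w.val.1 (arc v u) w.val.2
    have l₁ := log_natCast_mono (a := n.val.size) (b := t.size) (by omega)
    have l₂ := log_natCast_mono (a := z.val.2.size + z.val.1.size) (b := t.size) (by omega)
    push_cast at *
    linarith

theorem collect_spec (t : SplayTree (TourNode α)) (A : Finset α) :
    (collect t A).val = A ∪ tourVerts t.toList ∧ (collect t A).time = t.size := by
  induction t generalizing A with
  | nil => simp [collect, toList, tourVerts, size]
  | node l x r hl hr =>
    obtain ⟨hv, ht⟩ : (collect (node l x r) A).val = (collect r (match x with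
          | vtx v => insert v (collect l A).val
          | arc _ _ => (collect l A).val)).val ∧
        (collect (node l x r) A).time = (collect l A).time + (1 + (collect r (match x with
          | vtx v => insert v (collect l A).val
          | arc _ _ => (collect l A).val)).time) := ⟨rfl, rfl⟩
    rw [hv, ht, (hl A).2, (hr _).1, (hr _).2, (hl A).1]
    refine ⟨?_, by simp only [size]; omega⟩
    ext w
    cases x with
    | vtx v => simp [toList, mem_tourVerts]; tauto
    | arc u v => simp [toList, mem_tourVerts]

end TreeOperations

/-! ### The potential of a partition into hash sets -/

/-- The function `n log n`. -/
noncomputable def mulLog (n : ℕ) : ℝ := n * Real.log n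

@[simp] theorem mulLog_zero : mulLog 0 = 0 := by simp [mulLog]

theorem mulLog_mono {a b : ℕ} (h : a ≤ b) : mulLog a ≤ mulLog b :=
  mul_le_mul (by exact_mod_cast h) (log_natCast_mono h) (Real.log_natCast_nonneg a)
    (Nat.cast_nonneg b)

theorem mulLog_add (a b : ℕ) : mulLog a + mulLog b ≤ mulLog (a + b) := by
  have h₁ := mul_le_mul_of_nonneg_left (log_natCast_mono (Nat.le_add_right a b))
    (Nat.cast_nonneg (α := ℝ) a)
  have h₂ := mul_le_mul_of_nonneg_left (log_natCast_mono (Nat.le_add_left b a))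
    (Nat.cast_nonneg (α := ℝ) b)
  simp only [mulLog]
  push_cast at *
  linarith

/-- For a ≤ b, the union at least doubles the size of the set of each of the a moved elements, which
gives a log 2 with 2 log 2 ≥ 1. -/
theorem min_le_mulLog (a b : ℕ) :
    (min a b : ℕ) + 2 * (mulLog a + mulLog b) ≤ 2 * mulLog (a + b) := by
  wlog h : a ≤ b generalizing a b
  · have := this b a (by omega)
    rwa [min_comm, add_comm b a, add_comm (mulLog b)] at this
  rw [min_eq_left h]
  rcases Nat.eq_zero_or_pos a with rfl | ha
  · simp
  have h₁ : Real.log a + Real.log 2 ≤ Real.log (a + b : ℕ) := by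
    rw [← Real.log_mul (by positivity) (by norm_num)]
    have : ((a * 2 : ℕ) : ℝ) ≤ (a + b : ℕ) := by exact_mod_cast (by omega)
    exact Real.log_le_log (by positivity) (by simpa using this)
  have h₂ := log_natCast_mono (Nat.le_add_left b a)
  have h₃ := mul_le_mul_of_nonneg_left h₁ (Nat.cast_nonneg (α := ℝ) a)
  have h₄ := mul_le_mul_of_nonneg_left h₂ (Nat.cast_nonneg (α := ℝ) b)
  have h₅ := mul_le_mul_of_nonneg_left Real.log_two_gt_d9.le (Nat.cast_nonneg (α := ℝ) a)
  have h₆ : (0 : ℝ) ≤ a := Nat.cast_nonneg a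
  simp only [mulLog]
  push_cast at *
  linarith

/-- This is log (1 + b/a) ≤ b/a, multiplied by a. -/
theorem mul_log_div_le {a c : ℕ} (b : ℕ) (h : c = a + b) :
    a * Real.log c ≤ a * Real.log a + b := by
  rcases Nat.eq_zero_or_pos a with rfl | ha
  · simp
  have ha' : (0 : ℝ) < a := by exact_mod_cast ha
  have hc : (0 : ℝ) < c := by exact_mod_cast (by omega : 0 < c)
  have h₁ := Real.log_le_sub_one_of_pos (div_pos hc ha')
  rw [Real.log_div hc.ne' ha'.ne'] at h₁
  have h₂ := mul_le_mul_of_nonneg_left h₁ ha'.le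
  have h₃ : (a : ℝ) * (c / a - 1) = b := by
    rw [h]; push_cast; field_simp; ring
  rw [h₃] at h₂
  linarith

/-- Splitting a set loses at most its size in k log k, which is comparable to the cost of scanning
it. -/
theorem mulLog_add_le (a b : ℕ) : mulLog (a + b) ≤ mulLog a + mulLog b + (a + b) := by
  have h₁ := mul_log_div_le (a := a) b rfl
  have h₂ := mul_log_div_le (a := b) (c := a + b) a (by omega)
  simp only [mulLog]
  push_cast at *
  linarith

theorem mulLog_succ_le (a : ℕ) : mulLog (a + 1) ≤ mulLog a + Real.log (a + 1 : ℕ) + 1 := by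
  have h₁ := mul_log_div_le (a := a) 1 rfl
  simp only [mulLog]
  push_cast at *
  linarith

theorem log_succ_add_one_le (a : ℕ) : Real.log (a + 1 : ℕ) + 1 ≤ (a + 1 : ℕ) := by
  have := Real.log_le_sub_one_of_pos (x := ((a + 1 : ℕ) : ℝ)) (by positivity)
  linarith

/-- Lets additive constants be absorbed into log |V| once there are two vertices. -/
theorem one_le_two_log {n : ℕ} (h : 2 ≤ n) : 1 ≤ 2 * Real.log n := by
  have := log_natCast_mono h
  have := Real.log_two_gt_d9
  push_cast at *
  linarith

/-- Since 3n ≤ n³ for n ≥ 2. It is applied to tours, whose length is at most three times the number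
of vertices. -/
theorem log_three_mul_le {m n : ℕ} (h : 2 ≤ n) (hm : m ≤ 3 * n) : Real.log m ≤ 3 * Real.log n := by
  have h₁ := log_natCast_mono (a := m) (b := n ^ 3) (by
    have : 4 ≤ n ^ 2 := by nlinarith
    calc m ≤ 3 * n := hm
      _ ≤ n ^ 2 * n := Nat.mul_le_mul_right _ (by omega)
      _ = n ^ 3 := by ring)
  rwa [Nat.cast_pow, Real.log_pow] at h₁

/-! ### The potential of a list of components -/

section Potential

variable {α : Type*} {S T : List (Component α)}

/-- The sum of the potentials of the splay trees. -/
noncomputable def treePotential (S : List (Component α)) : ℝ :=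
  (S.map fun c => c.tree.potential).sum

/-- The number of edges outside the spanning trees. -/
def nontreeCard (S : List (Component α)) : ℕ := (S.map fun c => c.nontree.card).sum

/-- The sum of `k log k` over the sizes `k` of the sets of non-tree edges. -/
noncomputable def nontreeLog (S : List (Component α)) : ℝ :=
  (S.map fun c => mulLog c.nontree.card).sum

/-- The potential of a list of components. -/
noncomputable def statePotential (S : List (Component α)) : ℝ :=
  treePotential S + 2 * (mulLog (nontreeCard S) - nontreeLog S)

theorem statePotential_perm (h : S.Perm T) : statePotential S = statePotential T := by
  simp only [statePotential, treePotential, nontreeCard, nontreeLog]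
  rw [(h.map _).sum_eq, (h.map _).sum_eq, (h.map _).sum_eq]

theorem statePotential_cons (c : Component α) (S : List (Component α)) :
    statePotential (c :: S) = c.tree.potential + treePotential S +
      2 * (mulLog (c.nontree.card + nontreeCard S) - (mulLog c.nontree.card + nontreeLog S)) := by
  simp [statePotential, treePotential, nontreeCard, nontreeLog]

theorem treePotential_nil : treePotential ([] : List (Component α)) = 0 := rfl

theorem treePotential_cons (c : Component α) (S : List (Component α)) :
    treePotential (c :: S) = c.tree.potential + treePotential S := by simp [treePotential]

theorem nontreeCard_nil : nontreeCard ([] : List (Component α)) = 0 := rfl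

theorem nontreeCard_cons (c : Component α) (S : List (Component α)) :
    nontreeCard (c :: S) = c.nontree.card + nontreeCard S := by simp [nontreeCard]

theorem nontreeLog_nil : nontreeLog ([] : List (Component α)) = 0 := rfl

theorem nontreeLog_cons (c : Component α) (S : List (Component α)) :
    nontreeLog (c :: S) = mulLog c.nontree.card + nontreeLog S := by simp [nontreeLog]

theorem treePotential_nonneg (S : List (Component α)) : 0 ≤ treePotential S := by
  induction S with
  | nil => simp [treePotential]
  | cons c S ih => rw [treePotential_cons]; exact add_nonneg (potential_nonneg _) ih

theorem nontreeLog_nonneg (S : List (Component α)) : 0 ≤ nontreeLog S := by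
  induction S with
  | nil => simp [nontreeLog]
  | cons c S ih =>
    rw [nontreeLog_cons]
    exact add_nonneg (mul_nonneg (Nat.cast_nonneg _) (Real.log_natCast_nonneg _)) ih

theorem nontreeLog_le (S : List (Component α)) : nontreeLog S ≤ mulLog (nontreeCard S) := by
  induction S with
  | nil => simp [nontreeLog, nontreeCard]
  | cons c S ih =>
    rw [nontreeLog_cons, nontreeCard_cons]
    linarith [mulLog_add c.nontree.card (nontreeCard S)]

/-- Superadditivity of n log n is what makes the entropy part nonnegative. -/
theorem statePotential_nonneg (S : List (Component α)) : 0 ≤ statePotential S := by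
  have := treePotential_nonneg S
  have := nontreeLog_le S
  rw [statePotential]; linarith

/-- The removed components have no non-tree edges and so do not enter the entropy part; only tree
potential is released. -/
theorem statePotential_filter (P : Component α → Bool) (hP : ∀ c, P c = false → c.nontree = ∅)
    (S : List (Component α)) : statePotential (S.filter P) ≤ statePotential S := by
  have : treePotential (S.filter P) ≤ treePotential S ∧
      nontreeCard (S.filter P) = nontreeCard S ∧ nontreeLog (S.filter P) = nontreeLog S := by
    induction S with
    | nil => simp
    | cons c S ih =>
      rw [treePotential_cons, nontreeCard_cons, nontreeLog_cons]
      cases hc : P c with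
      | true =>
        rw [List.filter_cons_of_pos hc, treePotential_cons, nontreeCard_cons, nontreeLog_cons,
          ih.2.1, ih.2.2]
        exact ⟨by linarith [ih.1], rfl, rfl⟩
      | false =>
        rw [List.filter_cons_of_neg (by simp [hc]), hP c hc, ih.2.1, ih.2.2]
        exact ⟨by linarith [ih.1, potential_nonneg c.tree], by simp, by simp⟩
  rw [statePotential, statePotential, this.2.1, this.2.2]
  linarith [this.1]

end Potential

/-! ### Valid lists of components -/

section Components

variable {α : Type*} [DecidableEq α]

namespace Component

/-- The vertices of the spanning tree. -/
def treeVerts (c : Component α) : Finset α := tourVerts c.tree.toList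

/-- The edges of a component. -/
def allEdges (c : Component α) : Finset (Sym2 α) := c.treeEdges ∪ c.nontree

/-- A component is valid up to the record of its vertex set. -/
structure Valid (c : Component α) : Prop where
  tour : IsEulerTour c.tree.toList c.treeVerts c.treeEdges
  nontree_mem : ∀ e ∈ c.nontree, ∀ v ∈ e, v ∈ c.treeVerts
  disjoint_edges : Disjoint c.treeEdges c.nontree

variable {c : Component α}

theorem treeEdges_eq (c : Component α) : c.treeEdges = tourEdges c.tree.toList := rfl

theorem mem_treeVerts {v : α} : v ∈ c.treeVerts ↔ vtx v ∈ c.tree.toList := mem_tourVerts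

theorem Valid.mem_of_mem_edge (h : c.Valid) {e : Sym2 α} (he : e ∈ c.allEdges) {v : α}
    (hv : v ∈ e) : v ∈ c.treeVerts := by
  rcases Finset.mem_union.1 he with he | he
  · exact (h.tour.edge_mem e he).2 v hv
  · exact h.nontree_mem e he v hv

theorem Valid.size_le (h : c.Valid) : c.tree.size ≤ 3 * c.treeVerts.card := by
  have := h.tour.length_le
  have := h.tour.card_eq
  rw [size_eq_length]; omega

theorem Valid.size_le_edges (h : c.Valid) : c.tree.size ≤ 3 * c.treeEdges.card + 1 := by
  have := h.tour.length_le
  have := h.tour.card_eq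
  rw [size_eq_length]; omega

theorem Valid.card_allEdges (h : c.Valid) :
    c.allEdges.card = c.treeEdges.card + c.nontree.card :=
  Finset.card_union_of_disjoint h.disjoint_edges

/-- Validity for a spanning tree with known vertices and edges. -/
theorem valid_of_tour {t : SplayTree (TourNode α)} {A : Finset α} {N : Finset (Sym2 α)}
    {W : Finset α} {F : Finset (Sym2 α)} (h : IsEulerTour t.toList W F)
    (hN : ∀ e ∈ N, ∀ v ∈ e, v ∈ W) (hd : Disjoint F N) :
    (⟨t, A, N⟩ : Component α).Valid ∧ (⟨t, A, N⟩ : Component α).treeVerts = W ∧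
      (⟨t, A, N⟩ : Component α).allEdges = F ∪ N := by
  obtain rfl := h.verts_eq
  obtain rfl := h.edges_eq
  exact ⟨⟨h, hN, hd⟩, rfl, rfl⟩

end Component

open Component

/-- The vertices of a list of components. -/
def vertsOf : List (Component α) → Finset α
  | [] => ∅
  | c :: S => c.treeVerts ∪ vertsOf S

/-- The edges of a list of components. -/
def edgesOf : List (Component α) → Finset (Sym2 α)
  | [] => ∅
  | c :: S => c.allEdges ∪ edgesOf S

/-- The components are valid and have disjoint vertex sets. -/
structure Valid (S : List (Component α)) : Prop where
  valid : ∀ c ∈ S, c.Valid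
  disjoint : S.Pairwise fun c d => Disjoint c.treeVerts d.treeVerts

variable {S T : List (Component α)} {c : Component α}

theorem mem_vertsOf {v : α} : v ∈ vertsOf S ↔ ∃ c ∈ S, v ∈ c.treeVerts := by
  induction S with
  | nil => simp [vertsOf]
  | cons c S ih => simp [vertsOf, ih]

theorem mem_edgesOf {e : Sym2 α} : e ∈ edgesOf S ↔ ∃ c ∈ S, e ∈ c.allEdges := by
  induction S with
  | nil => simp [edgesOf]
  | cons c S ih => simp [edgesOf, ih]

theorem vertsOf_perm (h : S.Perm T) : vertsOf S = vertsOf T := by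
  ext v; simp only [mem_vertsOf, h.mem_iff]

theorem edgesOf_perm (h : S.Perm T) : edgesOf S = edgesOf T := by
  ext v; simp only [mem_edgesOf, h.mem_iff]

theorem Valid.perm (h : S.Perm T) (hS : Valid S) : Valid T :=
  ⟨fun c hc => hS.valid c (h.mem_iff.2 hc),
    (h.pairwise_iff fun h => Disjoint.symm h).1 hS.disjoint⟩

theorem valid_cons : Valid (c :: S) ↔ c.Valid ∧ Disjoint c.treeVerts (vertsOf S) ∧ Valid S := by
  have : Disjoint c.treeVerts (vertsOf S) ↔ ∀ d ∈ S, Disjoint c.treeVerts d.treeVerts := by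
    simp only [Finset.disjoint_left, mem_vertsOf, not_exists, not_and]
    exact ⟨fun h d hd v hv => h hv d hd, fun h v hv d hd => h d hd hv⟩
  rw [this]
  constructor
  · intro h
    exact ⟨h.valid c (by simp), (List.pairwise_cons.1 h.disjoint).1,
      fun d hd => h.valid d (by simp [hd]), (List.pairwise_cons.1 h.disjoint).2⟩
  · rintro ⟨h₁, h₂, h₃⟩
    exact ⟨by simpa using ⟨h₁, h₃.valid⟩, List.pairwise_cons.2 ⟨h₂, h₃.disjoint⟩⟩

theorem Valid.mem_of_mem_edge (h : Valid S) {e : Sym2 α} (he : e ∈ edgesOf S) {v : α}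
    (hv : v ∈ e) : v ∈ vertsOf S := by
  obtain ⟨c, hc, he⟩ := mem_edgesOf.1 he
  exact mem_vertsOf.2 ⟨c, hc, (h.valid c hc).mem_of_mem_edge he hv⟩

theorem disjoint_edgesOf (h : Valid (c :: S)) : Disjoint c.allEdges (edgesOf S) := by
  obtain ⟨h₁, h₂, h₃⟩ := valid_cons.1 h
  refine Finset.disjoint_left.2 fun e he he' => ?_
  induction e using Sym2.ind with
  | _ x y =>
    exact Finset.disjoint_left.1 h₂ (h₁.mem_of_mem_edge he (Sym2.mem_mk_left x y))
      (h₃.mem_of_mem_edge he' (Sym2.mem_mk_left x y))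

theorem card_vertsOf_cons (h : Valid (c :: S)) :
    (vertsOf (c :: S)).card = c.treeVerts.card + (vertsOf S).card :=
  Finset.card_union_of_disjoint (valid_cons.1 h).2.1

theorem card_edgesOf_cons (h : Valid (c :: S)) :
    (edgesOf (c :: S)).card = c.treeEdges.card + c.nontree.card + (edgesOf S).card := by
  rw [edgesOf, Finset.card_union_of_disjoint (disjoint_edgesOf h),
    (valid_cons.1 h).1.card_allEdges]

/-- The field `verts` goes stale during an update and is repaired only by `rebuild`. The
intermediate invariant `Valid` therefore reads the vertices off the tour, and the agreement of both
is split off here. -/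
theorem represents_iff {G : FinGraph α} : Represents S G ↔
    Valid S ∧ (∀ c ∈ S, c.verts = c.treeVerts) ∧ vertsOf S = G.verts ∧ edgesOf S = G.edges := by
  constructor
  · intro h
    have hv : ∀ c ∈ S, c.verts = c.treeVerts := fun c hc => (h.tour c hc).verts_eq
    refine ⟨⟨fun c hc => ⟨?_, ?_, h.disjoint_edges c hc⟩, ?_⟩, hv, ?_, ?_⟩
    · rw [← hv c hc]; exact h.tour c hc
    · rw [← hv c hc]; exact h.nontree_mem c hc
    · refine h.disjoint_verts.imp_of_mem fun {c d} hc hd hcd => ?_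
      rwa [← hv c hc, ← hv d hd]
    · ext v
      rw [mem_vertsOf, h.verts]
      exact exists_congr fun c => and_congr_right fun hc => by rw [hv c hc]
    · ext e
      rw [mem_edgesOf, h.edges]
      exact exists_congr fun c => and_congr_right fun hc => by rw [allEdges, Finset.mem_union]
  · rintro ⟨h, hv, hV, hE⟩
    refine ⟨fun c hc => ?_, fun c hc => ?_, fun c hc => (h.valid c hc).disjoint_edges, ?_, ?_, ?_⟩
    · rw [hv c hc]; exact (h.valid c hc).tour
    · rw [hv c hc]; exact (h.valid c hc).nontree_mem
    · refine h.disjoint.imp_of_mem fun {c d} hc hd hcd => ?_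
      rwa [hv c hc, hv d hd]
    · intro v
      rw [← hV, mem_vertsOf]
      exact exists_congr fun c => and_congr_right fun hc => by rw [hv c hc]
    · intro e
      rw [← hE, mem_edgesOf]
      exact exists_congr fun c => and_congr_right fun hc => by rw [allEdges, Finset.mem_union]

/-- A crude bound suffices: it is used only as log |E| ≤ 2 log |V|. -/
theorem Valid.card_edgesOf_le (h : Valid S) : (edgesOf S).card ≤ (vertsOf S).card ^ 2 := by
  have hsub : edgesOf S ⊆ (vertsOf S ×ˢ vertsOf S).image fun p => s(p.1, p.2) := by
    intro e he
    induction e using Sym2.ind with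
    | _ x y =>
      exact Finset.mem_image.2 ⟨(x, y), Finset.mem_product.2 ⟨h.mem_of_mem_edge he (by simp),
        h.mem_of_mem_edge he (by simp)⟩, rfl⟩
  calc (edgesOf S).card ≤ _ := Finset.card_le_card hsub
    _ ≤ _ := Finset.card_image_le
    _ = _ := by rw [Finset.card_product, sq]

theorem Valid.nontreeCard_le (h : Valid S) : nontreeCard S ≤ (edgesOf S).card := by
  induction S with
  | nil => simp [nontreeCard]
  | cons c S ih =>
    have := ih (valid_cons.1 h).2.2
    rw [nontreeCard_cons, card_edgesOf_cons h]; omega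

/-- With at least two vertices, 36 = 4 · 3 · 3 comes from the definition of `potential`, the tour
length and `log_three_mul_le`. A single vertex has potential 0, which matters because n = 1 is then
possible. -/
theorem Component.Valid.potential_le (h : c.Valid) {n : ℕ} (hn : c.treeVerts.card ≤ n) :
    c.tree.potential ≤ 36 * (c.treeVerts.card * Real.log n) := by
  rcases Nat.lt_or_ge 1 c.treeVerts.card with h₁ | h₁
  · have h₂ := SplayTree.potential_le c.tree
    have h₃ := log_three_mul_le (n := n) (by omega) (h.size_le.trans (by omega))
    have h₄ : (c.tree.size : ℝ) ≤ 3 * c.treeVerts.card := by exact_mod_cast h.size_le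
    have h₅ := Real.log_natCast_nonneg n
    have : c.tree.size * Real.log c.tree.size ≤ (3 * c.treeVerts.card) * (3 * Real.log n) :=
      mul_le_mul h₄ h₃ (Real.log_natCast_nonneg _) (by positivity)
    linarith
  · have h₂ := SplayTree.potential_le c.tree
    have h₃ := h.tour.card_eq
    have h₄ : c.tree.size ≤ 1 := h.size_le_edges.trans (by omega)
    have h₅ : Real.log c.tree.size = 0 := by interval_cases c.tree.size <;> simp
    rw [h₅] at h₂
    have := Real.log_natCast_nonneg n
    have : 0 ≤ 36 * (c.treeVerts.card * Real.log n) := by positivity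
    linarith

theorem Valid.treePotential_le (h : Valid S) {n : ℕ} (hn : (vertsOf S).card ≤ n) :
    treePotential S ≤ 36 * ((vertsOf S).card * Real.log n) := by
  induction S with
  | nil => simp [treePotential, vertsOf]
  | cons c S ih =>
    rw [card_vertsOf_cons h] at hn ⊢
    have h₁ := ih (valid_cons.1 h).2.2 (by omega)
    have h₂ := (valid_cons.1 h).1.potential_le (n := n) (by omega)
    rw [treePotential_cons]
    push_cast
    linarith

theorem Valid.statePotential_le (h : Valid S) :
    statePotential S ≤
      36 * (((vertsOf S).card + (edgesOf S).card) * Real.log (vertsOf S).card) := by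
  have h₁ := h.treePotential_le le_rfl
  have h₂ := nontreeLog_nonneg S
  have h₃ : mulLog (nontreeCard S) ≤ (edgesOf S).card * (2 * Real.log (vertsOf S).card) := by
    have := log_natCast_mono (h.nontreeCard_le.trans h.card_edgesOf_le)
    rw [Nat.cast_pow, Real.log_pow] at this
    exact mul_le_mul (by exact_mod_cast h.nontreeCard_le) (by exact_mod_cast this)
      (Real.log_natCast_nonneg _) (Nat.cast_nonneg _)
  have h₄ : 0 ≤ ((edgesOf S).card : ℝ) * Real.log (vertsOf S).card :=
    mul_nonneg (Nat.cast_nonneg _) (Real.log_natCast_nonneg _)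
  rw [statePotential]
  linarith

end Components

/-! ### Finding a component, and deleting one edge inside it. -/

section Deletion

variable {α : Type*}

theorem treePotential_append (S T : List (Component α)) :
    treePotential (S ++ T) = treePotential S + treePotential T := by simp [treePotential]

theorem nontreeCard_append (S T : List (Component α)) :
    nontreeCard (S ++ T) = nontreeCard S + nontreeCard T := by simp [nontreeCard]

theorem nontreeLog_append (S T : List (Component α)) :
    nontreeLog (S ++ T) = nontreeLog S + nontreeLog T := by simp [nontreeLog]

variable [DecidableEq α] {S T : List (Component α)} {c d : Component α} {u v : α}

theorem vertsOf_append : vertsOf (S ++ T) = vertsOf S ∪ vertsOf T := by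
  induction S with
  | nil => simp [vertsOf]
  | cons c S ih => simp [vertsOf, ih]

theorem edgesOf_append : edgesOf (S ++ T) = edgesOf S ∪ edgesOf T := by
  induction S with
  | nil => simp [edgesOf]
  | cons c S ih => simp [edgesOf, ih]

theorem valid_append :
    Valid (S ++ T) ↔ Valid S ∧ Valid T ∧ Disjoint (vertsOf S) (vertsOf T) := by
  induction S with
  | nil =>
    simp only [List.nil_append, vertsOf, Finset.disjoint_empty_left, and_true]
    exact ⟨fun h => ⟨⟨by simp, by simp⟩, h⟩, fun h => h.2⟩
  | cons c S ih =>
    rw [List.cons_append, valid_cons, valid_cons, ih, vertsOf_append, vertsOf,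
      Finset.disjoint_union_right, Finset.disjoint_union_left]
    tauto

/-- The replacement of a component by a list of components without the edge `e`. -/
theorem Valid.replace {N : List (Component α)} {e : Sym2 α} (h : Valid (c :: S))
    (he : e ∈ c.allEdges) (hN : Valid N) (hv : vertsOf N = c.treeVerts)
    (hE : edgesOf N = c.allEdges.erase e) :
    Valid (N ++ S) ∧ vertsOf (N ++ S) = vertsOf (c :: S) ∧
      edgesOf (N ++ S) = (edgesOf (c :: S)).erase e := by
  refine ⟨valid_append.2 ⟨hN, (valid_cons.1 h).2.2, hv ▸ (valid_cons.1 h).2.1⟩, ?_, ?_⟩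
  · rw [vertsOf_append, hv, vertsOf]
  · rw [edgesOf_append, hE, edgesOf, Finset.erase_union_distrib,
      Finset.erase_eq_of_notMem (Finset.disjoint_left.1 (disjoint_edgesOf h) he)]

/-- Splaying alters the shape of a tree but not its tour, so it leaves all of this untouched. -/
theorem Valid.congr (h : Valid (c :: S)) (ht : d.tree.toList = c.tree.toList)
    (hn : d.nontree = c.nontree) :
    Valid (d :: S) ∧ d.treeVerts = c.treeVerts ∧ d.allEdges = c.allEdges := by
  have h₁ : d.treeVerts = c.treeVerts := by simp only [Component.treeVerts, ht]
  have h₂ : d.treeEdges = c.treeEdges := by simp only [Component.treeEdges, ht]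
  obtain ⟨hc, hd, hS⟩ := valid_cons.1 h
  refine ⟨valid_cons.2 ⟨⟨?_, ?_, ?_⟩, h₁ ▸ hd, hS⟩, h₁, by simp only [Component.allEdges, h₂, hn]⟩
  · rw [ht, h₁, h₂]; exact hc.tour
  · rw [hn, h₁]; exact hc.nontree_mem
  · rw [hn, h₂]; exact hc.disjoint_edges

theorem extract_spec (hv : v ∈ vertsOf S) :
    S.Perm ((extract v S).1 :: (extract v S).2) ∧ v ∈ (extract v S).1.treeVerts := by
  induction S with
  | nil => simp [vertsOf] at hv
  | cons c S ih =>
    by_cases h : vtx v ∈ c.tree.toList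
    · have e : extract v (c :: S) = (c, S) := by simp [extract, h]
      rw [e]
      exact ⟨List.Perm.refl _, Component.mem_treeVerts.2 h⟩
    · have e : extract v (c :: S) = ((extract v S).1, c :: (extract v S).2) := by
        simp [extract, h]
      rw [e]
      have hv' : v ∈ vertsOf S := by
        rcases Finset.mem_union.1 hv with hv | hv
        · exact absurd (Component.mem_treeVerts.1 hv) h
        · exact hv
      exact ⟨((ih hv').1.cons c).trans (List.Perm.swap _ _ _), (ih hv').2⟩

/-- The bound for the single splay tree involved; `findCC_spec` carries it over to the potential of
the whole state. -/
theorem findCC_tree (hv : v ∈ vertsOf S) :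
    (findCC v S).val.1.tree.toList = (extract v S).1.tree.toList ∧
    (findCC v S).time ≤ (extract v S).1.tree.size + 3 ∧
    (findCC v S).time + (findCC v S).val.1.tree.potential ≤
      (extract v S).1.tree.potential + 12 * Real.log (extract v S).1.tree.size + 6 := by
  have hm := Component.mem_treeVerts.1 (extract_spec hv).2
  have h₁ := splay_toList hm
  have h₂ := splay_time_le hm
  have h₃ := splay_amortized hm
  have ht : (findCC v S).time = 1 + ((splay (vtx v) (extract v S).1.tree).time + 0) := rfl
  have hT : (findCC v S).val.1.tree = node (splay (vtx v) (extract v S).1.tree).val.1 (vtx v)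
    (splay (vtx v) (extract v S).1.tree).val.2 := rfl
  rw [ht, hT]
  refine ⟨h₁, by omega, ?_⟩
  push_cast
  linarith

theorem findCC_spec (hS : Valid S) (hv : v ∈ vertsOf S) :
    Valid ((findCC v S).val.1 :: (findCC v S).val.2) ∧
    vertsOf ((findCC v S).val.1 :: (findCC v S).val.2) = vertsOf S ∧
    edgesOf ((findCC v S).val.1 :: (findCC v S).val.2) = edgesOf S ∧
    v ∈ (findCC v S).val.1.treeVerts ∧
    (findCC v S).time ≤ (findCC v S).val.1.tree.size + 3 ∧
    (findCC v S).time + statePotential ((findCC v S).val.1 :: (findCC v S).val.2) ≤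
      statePotential S + 12 * Real.log (findCC v S).val.1.tree.size + 6 := by
  obtain ⟨p, hm⟩ := extract_spec hv
  obtain ⟨h₁, h₂, h₃⟩ := findCC_tree hv
  have hs : (findCC v S).val.1.tree.size = (extract v S).1.tree.size := by
    rw [size_eq_length, h₁, ← size_eq_length]
  have hn : (findCC v S).val.1.nontree = (extract v S).1.nontree := rfl
  have hR : (findCC v S).val.2 = (extract v S).2 := rfl
  obtain ⟨hV, e₁, e₂⟩ := (hS.perm p).congr h₁ hn
  rw [← hs] at h₂ h₃
  rw [hR]
  refine ⟨hV, ?_, ?_, e₁ ▸ hm, h₂, ?_⟩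
  · rw [vertsOf_perm p, vertsOf, vertsOf, e₁]
  · rw [edgesOf_perm p, edgesOf, edgesOf, e₂]
  · rw [statePotential_perm p, statePotential_cons, statePotential_cons, hn]
    linarith

theorem search_spec (W : Finset α) (L : List (α × α)) (A B : Finset (Sym2 α)) :
    (search W L A B).time ≤ 3 * L.length ∧
    (∀ p, (search W L A B).val = Sum.inl p → p ∈ L ∧ ¬ (p.1 ∈ W ↔ p.2 ∈ W)) ∧
    (∀ q, (search W L A B).val = Sum.inr q → (∀ p ∈ L, p.1 ∈ W ↔ p.2 ∈ W) ∧
      (∀ e, e ∈ q.1 ↔ e ∈ A ∨ ∃ p ∈ L, p.1 ∉ W ∧ s(p.1, p.2) = e) ∧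
      (∀ e, e ∈ q.2 ↔ e ∈ B ∨ ∃ p ∈ L, p.1 ∈ W ∧ s(p.1, p.2) = e)) := by
  induction L generalizing A B with
  | nil =>
    refine ⟨by simp [search], fun p h => by simp [search] at h, fun q h => ?_⟩
    simp only [search, Timed.pure_val, Sum.inr.injEq] at h
    subst h
    simp
  | cons p L ih =>
    obtain ⟨x, y⟩ := p
    by_cases h : x ∈ W ↔ y ∈ W
    · by_cases hx : x ∈ W
      · have hy := h.1 hx
        obtain ⟨i₁, i₂, i₃⟩ := ih A (insert s(x, y) B)
        have ev : (search W ((x, y) :: L) A B).val = (search W L A (insert s(x, y) B)).val := by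
          simp [search, hx, hy]
        have et : (search W ((x, y) :: L) A B).time =
            (search W L A (insert s(x, y) B)).time + 3 := by
          simp [search, hx, hy]; omega
        rw [ev, et]
        refine ⟨by simp only [List.length_cons]; omega,
          fun p hp => ⟨List.mem_cons_of_mem _ (i₂ p hp).1, (i₂ p hp).2⟩, fun q hq => ?_⟩
        obtain ⟨j₁, j₂, j₃⟩ := i₃ q hq
        refine ⟨by simpa [hx, hy] using j₁, fun e => ?_, fun e => ?_⟩
        · rw [j₂]; simp [hx]
        · rw [j₃]; simp only [Finset.mem_insert, List.mem_cons, exists_eq_or_imp, hx, true_and]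
          rw [eq_comm (a := e)]; tauto
      · have hy := mt h.2 hx
        obtain ⟨i₁, i₂, i₃⟩ := ih (insert s(x, y) A) B
        have ev : (search W ((x, y) :: L) A B).val = (search W L (insert s(x, y) A) B).val := by
          simp [search, hx, hy]
        have et : (search W ((x, y) :: L) A B).time =
            (search W L (insert s(x, y) A) B).time + 3 := by
          simp [search, hx, hy]; omega
        rw [ev, et]
        refine ⟨by simp only [List.length_cons]; omega,
          fun p hp => ⟨List.mem_cons_of_mem _ (i₂ p hp).1, (i₂ p hp).2⟩, fun q hq => ?_⟩
        obtain ⟨j₁, j₂, j₃⟩ := i₃ q hq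
        refine ⟨by simpa [hx, hy] using j₁, fun e => ?_, fun e => ?_⟩
        · rw [j₂]
          simp only [Finset.mem_insert, List.mem_cons, exists_eq_or_imp, hx, true_and,
            not_false_eq_true]
          rw [eq_comm (a := e)]; tauto
        · rw [j₃]; simp [hx]
    · have ev : (search W ((x, y) :: L) A B).val = Sum.inl (x, y) := by simp [search, h]
      have et : (search W ((x, y) :: L) A B).time = 2 := by simp [search, h]
      rw [ev, et]
      refine ⟨by simp only [List.length_cons]; omega, fun p hp => ?_, fun q hq => by cases hq⟩
      cases hp
      exact ⟨by simp, h⟩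

theorem length_of_enumeration {L : List (α × α)} {A : Finset (Sym2 α)}
    (h : (undirected L).Nodup ∧ (undirected L).toFinset = A) : L.length = A.card := by
  rw [← h.2, List.toFinset_card_of_nodup h.1, undirected, List.length_map]

/-- The deletion of a tree edge, seen from its component. -/
def replaceTreeEdge (ord : Finset (Sym2 α) → List (α × α)) (u v : α) (c : Component α) :
    Timed (List (Component α)) := do
  let z ← cut u v c.tree
  let w ← step (if z.1.size < z.2.size then (z.2, z.1) else z)
  let W ← collect w.2 ∅
  let found ← search W (ord c.nontree) ∅ ∅
  match found with
  | Sum.inl (x, y) => do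
      tick
      let T ← if x ∈ W then link x y w.2 w.1 else link x y w.1 w.2
      let N ← step (c.nontree.erase s(x, y))
      pure [⟨T, c.verts, N⟩]
  | Sum.inr (A, B) => step [⟨w.1, c.verts, A⟩, ⟨w.2, c.verts, B⟩]

theorem deleteEdge_of_mem {ord : Finset (Sym2 α) → List (α × α)}
    (h : s(u, v) ∈ (findCC u S).val.1.nontree) :
    (deleteEdge ord u v S).val = [⟨(findCC u S).val.1.tree, (findCC u S).val.1.verts,
      (findCC u S).val.1.nontree.erase s(u, v)⟩] ++ (findCC u S).val.2 ∧
    (deleteEdge ord u v S).time = (findCC u S).time + 2 := by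
  simp [deleteEdge, h]

theorem deleteEdge_of_notMem {ord : Finset (Sym2 α) → List (α × α)}
    (h : s(u, v) ∉ (findCC u S).val.1.nontree) :
    (deleteEdge ord u v S).val =
      (replaceTreeEdge ord u v (findCC u S).val.1).val ++ (findCC u S).val.2 ∧
    (deleteEdge ord u v S).time =
      (findCC u S).time + (1 + (replaceTreeEdge ord u v (findCC u S).val.1).time) := by
  simp only [deleteEdge, replaceTreeEdge, Timed.bind_val, Timed.bind_time, Timed.tick_time,
    if_neg h, Timed.step_val, Timed.step_time]
  generalize findCC u S = f
  generalize cut u v f.val.1.tree = z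
  generalize (if z.val.1.size < z.val.2.size then (z.val.2, z.val.1) else z.val) = w
  generalize search (collect w.2 ∅).val (ord f.val.1.nontree) ∅ ∅ = r
  generalize r.val = q
  rcases q with ⟨x, y⟩ | ⟨A, B⟩
  · by_cases hx : x ∈ (collect w.2 ∅).val <;> simp [hx]
  · simp

/-- A non-tree edge between the two halves becomes the new linking edge; if there is none, every
non-tree edge lies inside one half, and the halves are components. The coefficient 152 = 40 + 112
stands for one cut and one link. The last two conclusions control the entropy part: the number of
non-tree edges does not grow, and Σ k log k drops by at most k. -/
theorem replaceTreeEdge_spec {ord : Finset (Sym2 α) → List (α × α)} (hord : IsEnumeration ord)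
    (hc : c.Valid) (he : s(u, v) ∈ c.treeEdges) :
    Valid (replaceTreeEdge ord u v c).val ∧
    vertsOf (replaceTreeEdge ord u v c).val = c.treeVerts ∧
    edgesOf (replaceTreeEdge ord u v c).val = c.allEdges.erase s(u, v) ∧
    (replaceTreeEdge ord u v c).time ≤ 14 * c.tree.size + 3 * c.nontree.card + 50 ∧
    (replaceTreeEdge ord u v c).time + treePotential (replaceTreeEdge ord u v c).val ≤
      c.tree.potential + 152 * Real.log c.tree.size + c.tree.size + 3 * c.nontree.card + 75 ∧
    nontreeCard (replaceTreeEdge ord u v c).val ≤ c.nontree.card ∧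
    mulLog c.nontree.card ≤ nontreeLog (replaceTreeEdge ord u v c).val + c.nontree.card := by
  obtain ⟨⟨W₁, W₂, F₁, F₂, -, -, k₁, k₂, k₃, k₄, k₅⟩, k₆, k₇, k₈⟩ := cut_spec hc.tour he
  set z := cut u v c.tree with hz
  obtain ⟨w, hw⟩ : ∃ w, w = if z.val.1.size < z.val.2.size then (z.val.2, z.val.1) else z.val :=
    ⟨_, rfl⟩
  obtain ⟨X, Y, FX, FY, hXY, hXYu, hF, tX, tY, hsize, hpot⟩ : ∃ X Y FX FY, Disjoint X Y ∧
      X ∪ Y = c.treeVerts ∧ FX ∪ FY = c.treeEdges.erase s(u, v) ∧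
      IsEulerTour w.1.toList X FX ∧ IsEulerTour w.2.toList Y FY ∧
      w.1.size + w.2.size + 2 = c.tree.size ∧
      w.1.potential + w.2.potential = z.val.1.potential + z.val.2.potential := by
    -- Which half is the smaller one is irrelevant from here on; `X` and `Y` name the halves after
    -- the exchange.
    rw [hw]
    split_ifs
    · exact ⟨W₂, W₁, F₂, F₁, k₁.symm, by rw [Finset.union_comm, k₂],
        by rw [Finset.union_comm, k₃], k₅, k₄, by simp only; omega, add_comm _ _⟩
    · exact ⟨W₁, W₂, F₁, F₂, k₁, k₂, k₃, k₄, k₅, k₆, rfl⟩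
  obtain ⟨c₁, c₂⟩ := collect_spec w.2 ∅
  rw [Finset.empty_union, ← tY.verts_eq] at c₁
  obtain ⟨s₁, s₂, s₃⟩ := search_spec Y (ord c.nontree) ∅ ∅
  rw [length_of_enumeration (hord c.nontree)] at s₁
  have hmemN : ∀ e, e ∈ c.nontree ↔ ∃ p ∈ ord c.nontree, s(p.1, p.2) = e := by
    intro e
    conv_lhs => rw [← (hord c.nontree).2]
    simp [undirected]
  have he' : s(u, v) ∉ c.nontree := Finset.disjoint_left.1 hc.disjoint_edges he
  have hall : c.allEdges.erase s(u, v) = (FX ∪ FY) ∪ c.nontree := by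
    rw [Component.allEdges, Finset.erase_union_distrib, hF, Finset.erase_eq_of_notMem he']
  have hFn : Disjoint (FX ∪ FY) c.nontree :=
    hF ▸ hc.disjoint_edges.mono_left (Finset.erase_subset _ _)
  rcases hq : (search Y (ord c.nontree) ∅ ∅).val with ⟨x, y⟩ | ⟨A, B⟩
  · obtain ⟨hxy, hiff⟩ := s₂ _ hq
    have hN : s(x, y) ∈ c.nontree := (hmemN _).2 ⟨_, hxy, rfl⟩
    have hx : x ∈ X ∪ Y := hXYu ▸ hc.nontree_mem _ hN x (by simp)
    have hy : y ∈ X ∪ Y := hXYu ▸ hc.nontree_mem _ hN y (by simp)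
    obtain ⟨T, hT⟩ : ∃ T, T = if x ∈ Y then link x y w.2 w.1 else link x y w.1 w.2 := ⟨_, rfl⟩
    have hv : (replaceTreeEdge ord u v c).val =
        [⟨T.val, c.verts, c.nontree.erase s(x, y)⟩] := by
      simp only [replaceTreeEdge, Timed.bind_val, ← hz, Timed.step_val, ← hw, c₁, hq, hT]
      split_ifs <;> rfl
    have ht : (replaceTreeEdge ord u v c).time = z.time + (1 + (w.2.size +
        ((search Y (ord c.nontree) ∅ ∅).time + (1 + (T.time + 1))))) := by
      simp only [replaceTreeEdge, Timed.bind_time, ← hz, Timed.step_val,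
        Timed.step_time, ← hw, c₁, c₂, hq, hT]
      split_ifs <;> rfl
    obtain ⟨l₁, l₂, l₃⟩ : IsEulerTour T.val.toList c.treeVerts (insert s(x, y) (FX ∪ FY)) ∧
        T.time ≤ 9 * (w.1.size + w.2.size) + 34 ∧ T.time + T.val.potential ≤
          w.1.potential + w.2.potential + 112 * Real.log c.tree.size + 49 := by
      rw [hT, ← hXYu, ← hsize]
      split_ifs with hxY
      · have hyX : y ∈ X := (Finset.mem_union.1 hy).resolve_right fun h => hiff (by simp [hxY, h])
        obtain ⟨l₁, -, l₂, l₃⟩ := link_spec tY tX hXY.symm hxY hyX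
        rw [Finset.union_comm X, Finset.union_comm FX, add_comm w.1.size]
        exact ⟨l₁, l₂, by linarith⟩
      · have hxX : x ∈ X := (Finset.mem_union.1 hx).resolve_right hxY
        have hyY : y ∈ Y := by
          by_contra h
          exact hiff (by simp [hxY, h])
        obtain ⟨l₁, -, l₂, l₃⟩ := link_spec tX tY hXY hxX hyY
        exact ⟨l₁, l₂, l₃⟩
    have hd : Disjoint (insert s(x, y) (FX ∪ FY)) (c.nontree.erase s(x, y)) :=
      Finset.disjoint_insert_left.2 ⟨Finset.notMem_erase _ _,
        hFn.mono_right (Finset.erase_subset _ _)⟩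
    obtain ⟨m₁, m₂, m₃⟩ := Component.valid_of_tour (A := c.verts) l₁
      (fun e he => hc.nontree_mem e (Finset.mem_of_mem_erase he)) hd
    have hcard := Finset.card_erase_add_one hN
    rw [hv, ht]
    simp only [valid_cons, vertsOf, edgesOf, Finset.union_empty, m₂, m₃, treePotential_cons,
      nontreeCard_cons, nontreeLog_cons, treePotential_nil, nontreeCard_nil, nontreeLog_nil,
      add_zero]
    refine ⟨⟨m₁, by simp, by simp, by simp⟩, trivial, ?_, by omega, ?_, by omega, ?_⟩
    · rw [hall, Finset.insert_union, ← Finset.union_insert, Finset.insert_erase hN]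
    · have : (w.2.size : ℝ) ≤ c.tree.size := by exact_mod_cast (by omega)
      have : ((search Y (ord c.nontree) ∅ ∅).time : ℝ) ≤ 3 * c.nontree.card := by
        exact_mod_cast s₁
      push_cast
      linarith
    · rw [← hcard]
      have := mulLog_succ_le (c.nontree.erase s(x, y)).card
      have := log_succ_add_one_le (c.nontree.erase s(x, y)).card
      linarith
  · obtain ⟨hiff, hA, hB⟩ := s₃ _ hq
    simp only [Finset.notMem_empty, false_or] at hA hB
    have hv : (replaceTreeEdge ord u v c).val =
        [⟨w.1, c.verts, A⟩, ⟨w.2, c.verts, B⟩] := by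
      simp only [replaceTreeEdge, Timed.bind_val, ← hz, Timed.step_val, ← hw, c₁, hq]
    have ht : (replaceTreeEdge ord u v c).time = z.time + (1 + (w.2.size +
        ((search Y (ord c.nontree) ∅ ∅).time + 1))) := by
      simp only [replaceTreeEdge, Timed.bind_time, ← hz, Timed.step_val,
        Timed.step_time, ← hw, c₁, c₂, hq]
    -- The enumeration lists each edge in one direction only, but the condition is symmetric in the
    -- two ends.
    have hends : ∀ x y, s(x, y) ∈ c.nontree → (x ∈ Y ↔ y ∈ Y) := by
      intro x y hxy
      obtain ⟨p, hp, e⟩ := (hmemN _).1 hxy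
      rcases Sym2.eq_iff.1 e with ⟨rfl, rfl⟩ | ⟨rfl, rfl⟩
      · exact hiff p hp
      · exact (hiff p hp).symm
    have hA' : ∀ e ∈ A, e ∈ c.nontree ∧ ∀ x ∈ e, x ∉ Y := by
      intro e he
      obtain ⟨p, hp, hpY, rfl⟩ := (hA e).1 he
      refine ⟨(hmemN _).2 ⟨p, hp, rfl⟩, fun x hx => ?_⟩
      rcases Sym2.mem_iff.1 hx with rfl | rfl
      · exact hpY
      · exact fun h => hpY ((hiff p hp).2 h)
    have hB' : ∀ e ∈ B, e ∈ c.nontree ∧ ∀ x ∈ e, x ∈ Y := by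
      intro e he
      obtain ⟨p, hp, hpY, rfl⟩ := (hB e).1 he
      refine ⟨(hmemN _).2 ⟨p, hp, rfl⟩, fun x hx => ?_⟩
      rcases Sym2.mem_iff.1 hx with rfl | rfl
      · exact hpY
      · exact (hiff p hp).1 hpY
    have hAB : A ∪ B = c.nontree := by
      ext e
      rw [Finset.mem_union]
      refine ⟨fun h => h.elim (fun h => (hA' e h).1) fun h => (hB' e h).1, fun h => ?_⟩
      obtain ⟨p, hp, rfl⟩ := (hmemN _).1 h
      by_cases hpY : p.1 ∈ Y
      · exact Or.inr ((hB _).2 ⟨p, hp, hpY, rfl⟩)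
      · exact Or.inl ((hA _).2 ⟨p, hp, hpY, rfl⟩)
    have hABd : Disjoint A B := Finset.disjoint_left.2 fun e h h' => by
      induction e using Sym2.ind with
      | _ x y => exact (hA' _ h).2 x (by simp) ((hB' _ h').2 x (by simp))
    have hXmem : ∀ e ∈ A, ∀ x ∈ e, x ∈ X := fun e he x hx => by
      have : x ∈ X ∪ Y := hXYu ▸ hc.nontree_mem e (hA' e he).1 x hx
      exact (Finset.mem_union.1 this).resolve_right ((hA' e he).2 x hx)
    obtain ⟨m₁, m₂, m₃⟩ := Component.valid_of_tour (A := c.verts) tX hXmem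
      (hFn.mono Finset.subset_union_left (hAB ▸ Finset.subset_union_left))
    obtain ⟨n₁, n₂, n₃⟩ := Component.valid_of_tour (A := c.verts) tY
      (fun e he => (hB' e he).2) (hFn.mono Finset.subset_union_right (hAB ▸ Finset.subset_union_right))
    have hcard := Finset.card_union_of_disjoint hABd
    rw [hAB] at hcard
    rw [hv, ht]
    simp only [valid_cons, vertsOf, edgesOf, Finset.union_empty, m₂, m₃, n₂, n₃,
      treePotential_cons, nontreeCard_cons, nontreeLog_cons, treePotential_nil, nontreeCard_nil,
      nontreeLog_nil, add_zero]
    refine ⟨⟨m₁, hXY, n₁, by simp, by simp, by simp⟩, hXYu, ?_, by omega, ?_, by omega, ?_⟩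
    · rw [hall, ← hAB, Finset.union_union_union_comm]
    · have : (w.2.size : ℝ) ≤ c.tree.size := by exact_mod_cast (by omega)
      have : ((search Y (ord c.nontree) ∅ ∅).time : ℝ) ≤ 3 * c.nontree.card := by
        exact_mod_cast s₁
      have := Real.log_natCast_nonneg c.tree.size
      push_cast
      linarith
    · rw [hcard]
      have := mulLog_add_le A.card B.card
      push_cast
      linarith

end Deletion

/-! ### The loops of both updates: edges, isolated vertices, vertex sets. -/

section Updates

variable {α : Type*} [DecidableEq α] {S T : List (Component α)} {c d : Component α} {u v : α}

theorem Valid.two_le_card (hu : u ∈ vertsOf S) (hv : v ∈ vertsOf S) (hne : u ≠ v) :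
    2 ≤ (vertsOf S).card :=
  Finset.one_lt_card.2 ⟨u, hu, v, hv, hne⟩

theorem Valid.log_size_le (h : Valid (c :: S)) (hn : 2 ≤ (vertsOf (c :: S)).card) :
    Real.log c.tree.size ≤ 3 * Real.log (vertsOf (c :: S)).card := by
  refine log_three_mul_le hn ((valid_cons.1 h).1.size_le.trans ?_)
  rw [card_vertsOf_cons h]; omega

/-- All work takes place in one component, whose tour and non-tree edges together have size O(|E|);
constants are absorbed because the deleted edge itself shows |E| ≥ 1. Only splay potentials
contribute the logarithm. -/
theorem deleteEdge_spec {ord : Finset (Sym2 α) → List (α × α)} (hord : IsEnumeration ord)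
    (hS : Valid S) (he : s(u, v) ∈ edgesOf S) (hne : u ≠ v) :
    Valid (deleteEdge ord u v S).val ∧
    vertsOf (deleteEdge ord u v S).val = vertsOf S ∧
    edgesOf (deleteEdge ord u v S).val = (edgesOf S).erase s(u, v) ∧
    (deleteEdge ord u v S).time ≤ 200 * (edgesOf S).card ∧
    (deleteEdge ord u v S).time + statePotential (deleteEdge ord u v S).val ≤
      statePotential S + 1000 * (Real.log (vertsOf S).card + (edgesOf S).card) := by
  have hu := hS.mem_of_mem_edge he (Sym2.mem_mk_left u v)
  have hv := hS.mem_of_mem_edge he (Sym2.mem_mk_right u v)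
  have hn := Valid.two_le_card hu hv hne
  have hlog := one_le_two_log hn
  have hEpos := Finset.card_pos.2 ⟨_, he⟩
  obtain ⟨f₁, f₂, f₃, f₄, f₅, f₆⟩ := findCC_spec hS hu
  have hsz := f₁.log_size_le (f₂ ▸ hn)
  have hcard := card_edgesOf_cons f₁
  rw [f₂] at hsz
  rw [f₃] at hcard
  obtain ⟨hc, hd, hR⟩ := valid_cons.1 f₁
  have hc' := hc.size_le_edges
  have hec : s(u, v) ∈ (findCC u S).val.1.allEdges := by
    rw [← f₃, edgesOf, Finset.mem_union] at he
    exact he.resolve_right fun h =>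
      Finset.disjoint_left.1 hd f₄ (hR.mem_of_mem_edge h (Sym2.mem_mk_left u v))
  rw [← f₂, ← f₃]
  rw [← f₂] at hlog hsz
  rw [← f₃] at hEpos hcard
  rw [statePotential_cons] at f₆
  by_cases hmem : s(u, v) ∈ (findCC u S).val.1.nontree
  · obtain ⟨ev, et⟩ := deleteEdge_of_mem (ord := ord) hmem
    rw [ev, et]
    generalize (findCC u S).val.1 = c at *
    generalize (findCC u S).val.2 = R at *
    have hnt : s(u, v) ∉ c.treeEdges := Finset.disjoint_right.1 hc.disjoint_edges hmem
    obtain ⟨m₁, m₂, m₃⟩ := Component.valid_of_tour (A := c.verts) hc.tour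
      (fun e he => hc.nontree_mem e (Finset.mem_of_mem_erase he))
      (hc.disjoint_edges.mono_right (Finset.erase_subset s(u, v) _))
    obtain ⟨r₁, r₂, r₃⟩ := f₁.replace hec
      (N := [⟨c.tree, c.verts, c.nontree.erase s(u, v)⟩])
      (valid_cons.2 ⟨m₁, by simp [vertsOf], by simp, by simp⟩) (by simp [vertsOf, m₂])
      (by rw [edgesOf, edgesOf, Finset.union_empty, m₃, Component.allEdges,
        Finset.erase_union_distrib, Finset.erase_eq_of_notMem hnt])
    refine ⟨r₁, r₂, r₃, by omega, ?_⟩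
    have hk := Finset.card_erase_add_one hmem
    -- Dropping one element costs log k + 1 in k log k; replacing this by k is wasteful but stays
    -- below |E|.
    have h₁ := mulLog_succ_le (c.nontree.erase s(u, v)).card
    have h₂ := log_succ_add_one_le (c.nontree.erase s(u, v)).card
    have h₃ := mulLog_mono (a := (c.nontree.erase s(u, v)).card + nontreeCard R)
      (b := c.nontree.card + nontreeCard R) (by omega)
    have h₄ : (c.nontree.card : ℝ) ≤ (edgesOf (c :: R)).card := by exact_mod_cast (by omega)
    have h₅ : (1 : ℝ) ≤ (edgesOf (c :: R)).card := by exact_mod_cast hEpos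
    rw [hk] at h₁ h₂
    rw [List.singleton_append, statePotential_cons]
    push_cast
    linarith
  · obtain ⟨ev, et⟩ := deleteEdge_of_notMem (ord := ord) hmem
    have het := (Finset.mem_union.1 hec).resolve_right hmem
    obtain ⟨p₁, p₂, p₃, p₄, p₅, p₆, p₇⟩ := replaceTreeEdge_spec hord hc het
    obtain ⟨r₁, r₂, r₃⟩ := f₁.replace hec p₁ p₂ p₃
    rw [ev, et]
    generalize replaceTreeEdge ord u v (findCC u S).val.1 = r at *
    generalize (findCC u S).val.1 = c at *
    generalize (findCC u S).val.2 = R at *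
    refine ⟨r₁, r₂, r₃, by omega, ?_⟩
    have h₃ := mulLog_mono (a := nontreeCard r.val + nontreeCard R)
      (b := c.nontree.card + nontreeCard R) (by omega)
    have h₄ : (c.nontree.card : ℝ) ≤ (edgesOf (c :: R)).card := by exact_mod_cast (by omega)
    have h₅ : (1 : ℝ) ≤ (edgesOf (c :: R)).card := by exact_mod_cast hEpos
    have h₆ : (c.tree.size : ℝ) ≤ 4 * (edgesOf (c :: R)).card := by exact_mod_cast (by omega)
    rw [statePotential, treePotential_append, nontreeCard_append, nontreeLog_append]
    push_cast
    linarith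

theorem deleteEdges_cons (ord : Finset (Sym2 α) → List (α × α)) (p : α × α) (L : List (α × α)) :
    (deleteEdges ord (p :: L) S).val =
      (deleteEdges ord L (deleteEdge ord p.1 p.2 S).val).val ∧
    (deleteEdges ord (p :: L) S).time = (deleteEdge ord p.1 p.2 S).time +
      (deleteEdges ord L (deleteEdge ord p.1 p.2 S).val).time := ⟨rfl, rfl⟩

/-- The parameters `n` and `m` stay fixed during the induction, since the vertices do not change and
the edges only become fewer. -/
theorem deleteEdges_spec {ord : Finset (Sym2 α) → List (α × α)} (hord : IsEnumeration ord)
    {L : List (α × α)} {n m : ℕ} (hS : Valid S) (hnd : (undirected L).Nodup)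
    (hL : ∀ e ∈ undirected L, e ∈ edgesOf S ∧ ¬ e.IsDiag) (hn : (vertsOf S).card = n)
    (hm : (edgesOf S).card ≤ m) :
    Valid (deleteEdges ord L S).val ∧
    vertsOf (deleteEdges ord L S).val = vertsOf S ∧
    edgesOf (deleteEdges ord L S).val = edgesOf S \ (undirected L).toFinset ∧
    (deleteEdges ord L S).time ≤ L.length * (200 * m) ∧
    (deleteEdges ord L S).time + statePotential (deleteEdges ord L S).val ≤
      statePotential S + L.length * (1000 * (Real.log n + m)) := by
  induction L generalizing S with
  | nil => simp [deleteEdges, undirected, hS]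
  | cons p L ih =>
    obtain ⟨h₁, h₂⟩ := hL s(p.1, p.2) (by simp [undirected])
    obtain ⟨d₁, d₂, d₃, d₄, d₅⟩ := deleteEdge_spec hord hS h₁ (by simpa using h₂)
    have hnd' : s(p.1, p.2) ∉ undirected L ∧ (undirected L).Nodup := List.nodup_cons.1 hnd
    obtain ⟨ev, et⟩ := deleteEdges_cons (S := S) ord p L
    rw [ev, et]
    generalize deleteEdge ord p.1 p.2 S = r at *
    obtain ⟨i₁, i₂, i₃, i₄, i₅⟩ := ih (S := r.val) d₁ hnd'.2 (fun e he => by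
        rw [d₃, Finset.mem_erase]
        have := hL e (by simp only [undirected, List.map_cons, List.mem_cons] at he ⊢; exact Or.inr he)
        exact ⟨⟨fun h => hnd'.1 (h ▸ he), this.1⟩, this.2⟩) (d₂ ▸ hn)
      (by rw [d₃]; exact (Finset.card_erase_le).trans hm)
    refine ⟨i₁, i₂.trans d₂, ?_, ?_, ?_⟩
    · rw [i₃, d₃, undirected, undirected, List.map_cons, List.toFinset_cons]
      ext e; simp only [Finset.mem_sdiff, Finset.mem_erase, Finset.mem_insert]; tauto
    · rw [List.length_cons, Nat.add_mul, one_mul]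
      have := Nat.mul_le_mul_left 200 hm
      omega
    · rw [hn] at d₅
      have : ((edgesOf S).card : ℝ) ≤ m := by exact_mod_cast hm
      rw [List.length_cons]
      push_cast
      linarith

theorem deleteVertices_cons (L : List α) : (deleteVertices (v :: L) S).val =
      (deleteVertices L (S.filter fun c =>
        decide (¬ (c.tree.toList = [vtx v] ∧ c.nontree = ∅)))).val ∧
    (deleteVertices (v :: L) S).time = 1 + (deleteVertices L (S.filter fun c =>
        decide (¬ (c.tree.toList = [vtx v] ∧ c.nontree = ∅)))).time := ⟨rfl, rfl⟩

theorem Valid.filter (hS : Valid S) (P : Component α → Bool) : Valid (S.filter P) :=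
  ⟨fun c hc => hS.valid c (List.mem_of_mem_filter hc), hS.disjoint.filter P⟩

/-- A connected component containing a vertex without edges is this vertex alone, so the test for a
one-node tour catches exactly the component of `v`. -/
theorem filter_isolated (hS : Valid S) (hv : ∀ e ∈ edgesOf S, v ∉ e) :
    vertsOf (S.filter fun c => decide (¬ (c.tree.toList = [vtx v] ∧ c.nontree = ∅))) =
      (vertsOf S).erase v ∧
    edgesOf (S.filter fun c => decide (¬ (c.tree.toList = [vtx v] ∧ c.nontree = ∅))) =
      edgesOf S := by
  constructor
  · ext w
    simp only [mem_vertsOf, Finset.mem_erase, List.mem_filter, decide_eq_true_eq]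
    constructor
    · rintro ⟨c, ⟨hc, hne⟩, hw⟩
      refine ⟨?_, c, hc, hw⟩
      rintro rfl
      apply hne
      have hval := hS.valid c hc
      have hcE : ∀ e ∈ c.allEdges, e ∈ edgesOf S := fun e he => mem_edgesOf.2 ⟨c, hc, he⟩
      have hwl := Component.mem_treeVerts.1 hw
      -- the vertex has no tree edge, so that the tour cannot leave it
      have hmem : ∀ x ∈ c.treeVerts, x = w := by
        obtain ⟨-, -, -, h₄, ⟨a, ha, ht⟩, -⟩ := isEulerTour_iff.1 hval.tour
        have hreach : ∀ x ∈ c.treeVerts, (SimpleGraph.fromEdgeSet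
            (c.treeEdges : Set (Sym2 α))).Reachable w x := fun x hx =>
          have r := (traverse_reachable ht fun x y => (h₄ x y).1).2
          (r _ hwl).1.symm.trans (r _ (Component.mem_treeVerts.1 hx)).1
        intro x hx
        obtain ⟨p⟩ := hreach x hx
        cases p with
        | nil => rfl
        | cons h _ =>
          exact absurd (Sym2.mem_mk_left _ _)
            (hv _ (hcE _ (Finset.mem_union_left _ h.1)))
      have hempty : ∀ e, e ∉ c.allEdges := by
        intro e he
        induction e using Sym2.ind with
        | _ x y =>
          obtain rfl := hmem x (hval.mem_of_mem_edge he (by simp))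
          exact hv _ (hcE _ he) (by simp)
      constructor
      · have hall : ∀ n ∈ c.tree.toList, n = vtx w := by
          intro n hn
          cases n with
          | vtx x => rw [hmem x (Component.mem_treeVerts.2 hn)]
          | arc x y =>
            exact absurd (Finset.mem_union_left _ ((hval.tour.arc_mem x y).1 hn)) (hempty _)
        -- All nodes of the tour are equal and the tour has no repetition, so its length is 1.
        have hrep := List.eq_replicate_of_mem hall
        have hnd := hval.tour.nodup
        rw [hrep, List.nodup_replicate] at hnd
        have hpos := List.length_pos_of_mem hwl
        rw [hrep, show c.tree.toList.length = 1 by omega]; rfl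
      · exact Finset.eq_empty_of_forall_notMem fun e he => hempty e (Finset.mem_union_right _ he)
    · rintro ⟨hne, c, hc, hw⟩
      refine ⟨c, ⟨hc, fun h => hne ?_⟩, hw⟩
      have := Component.mem_treeVerts.1 hw
      rw [h.1] at this
      simpa using this
  · ext e
    simp only [mem_edgesOf, List.mem_filter, decide_eq_true_eq]
    constructor
    · rintro ⟨c, ⟨hc, -⟩, he⟩
      exact ⟨c, hc, he⟩
    · rintro ⟨c, hc, he⟩
      refine ⟨c, ⟨hc, fun h => ?_⟩, he⟩
      rcases Finset.mem_union.1 he with he | he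
      · rw [Component.treeEdges_eq, mem_tourEdges] at he
        obtain ⟨x, y, hxy, -⟩ := he
        rw [h.1] at hxy
        simp at hxy
      · rw [h.2] at he
        simp at he

theorem deleteVertices_spec {L : List α} (hS : Valid S)
    (hL : ∀ v ∈ L, ∀ e ∈ edgesOf S, v ∉ e) :
    Valid (deleteVertices L S).val ∧
    vertsOf (deleteVertices L S).val = vertsOf S \ L.toFinset ∧
    edgesOf (deleteVertices L S).val = edgesOf S ∧
    (deleteVertices L S).time = L.length ∧
    statePotential (deleteVertices L S).val ≤ statePotential S := by
  induction L generalizing S with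
  | nil => simp [deleteVertices, hS]
  | cons v L ih =>
    obtain ⟨ev, et⟩ := deleteVertices_cons (S := S) (v := v) L
    obtain ⟨f₁, f₂⟩ := filter_isolated hS (hL v (by simp))
    have f₃ := statePotential_filter
      (fun c : Component α => decide (¬ (c.tree.toList = [vtx v] ∧ c.nontree = ∅)))
      (fun c hc => by simp only [decide_eq_false_iff_not, not_not] at hc; exact hc.2) S
    have f₄ := hS.filter fun c => decide (¬ (c.tree.toList = [vtx v] ∧ c.nontree = ∅))
    rw [ev, et]
    generalize (S.filter fun c => decide (¬ (c.tree.toList = [vtx v] ∧ c.nontree = ∅))) = R at *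
    obtain ⟨i₁, i₂, i₃, i₄, i₅⟩ := ih f₄ fun w hw => f₂ ▸ hL w (by simp [hw])
    refine ⟨i₁, ?_, i₃.trans f₂, by rw [i₄, List.length_cons, add_comm], i₅.trans f₃⟩
    rw [i₂, f₁]
    ext w; simp only [Finset.mem_sdiff, Finset.mem_erase, List.toFinset_cons, Finset.mem_insert]
    tauto

theorem rebuild_spec (hS : Valid S) :
    (rebuild S).val = S.map (fun c => ⟨c.tree, c.treeVerts, c.nontree⟩) ∧
      (rebuild S).time ≤ 3 * (vertsOf S).card := by
  induction S with
  | nil => exact ⟨rfl, Nat.zero_le _⟩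
  | cons c S ih =>
    obtain ⟨hc, hd, hS'⟩ := valid_cons.1 hS
    obtain ⟨i₁, i₂⟩ := ih hS'
    obtain ⟨c₁, c₂⟩ := collect_spec c.tree ∅
    have hv : (rebuild (c :: S)).val =
      ⟨c.tree, (collect c.tree ∅).val, c.nontree⟩ :: (rebuild S).val := rfl
    have ht : (rebuild (c :: S)).time = (collect c.tree ∅).time + ((rebuild S).time + 0) := rfl
    rw [hv, ht, c₁, c₂, i₁, Finset.empty_union, card_vertsOf_cons hS]
    refine ⟨rfl, ?_⟩
    have := hc.size_le
    omega

/-- The potential ignores the field `verts`, so the traversal of all tours costs only its time, at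
most three steps per vertex. -/
theorem rebuild_represents {G : FinGraph α} (hS : Valid S) (hv : vertsOf S = G.verts)
    (he : edgesOf S = G.edges) :
    Represents (rebuild S).val G ∧ (rebuild S).time ≤ 3 * G.verts.card ∧
      statePotential (rebuild S).val = statePotential S := by
  obtain ⟨h₁, h₂⟩ := rebuild_spec hS
  rw [h₁, ← hv]
  refine ⟨represents_iff.2 ⟨⟨?_, ?_⟩, ?_, ?_, ?_⟩, h₂, ?_⟩
  · intro c hc
    obtain ⟨d, hd, rfl⟩ := List.mem_map.1 hc
    have := hS.valid d hd
    exact ⟨this.tour, this.nontree_mem, this.disjoint_edges⟩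
  · exact List.pairwise_map.2 hS.disjoint
  · intro c hc
    obtain ⟨d, hd, rfl⟩ := List.mem_map.1 hc
    rfl
  · rw [← hv]
    ext v
    simp only [mem_vertsOf, List.mem_map, exists_exists_and_eq_and]
    rfl
  · rw [← he]
    ext v
    simp only [mem_edgesOf, List.mem_map, exists_exists_and_eq_and]
    rfl
  · simp only [statePotential, treePotential, nontreeCard, nontreeLog, List.map_map]
    rfl

theorem single_spec (v : α) (A : Finset α) :
    (⟨single (vtx v), A, ∅⟩ : Component α).Valid ∧
    (⟨single (vtx v), A, ∅⟩ : Component α).treeVerts = {v} ∧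
    (⟨single (vtx v), A, ∅⟩ : Component α).allEdges = ∅ := by
  have h : IsEulerTour (single (vtx v)).toList {v} (∅ : Finset (Sym2 α)) := by
    rw [toList_single]
    exact isEulerTour_iff.2 ⟨by simp, by simp, by simp, by simp,
      ⟨v, by simp, rfl, rfl⟩, by simp⟩
  exact Component.valid_of_tour h (by simp) (by simp)

theorem insertVertices_spec {L : List α} (hS : Valid S) (hnd : L.Nodup)
    (hL : ∀ v ∈ L, v ∉ vertsOf S) :
    Valid (insertVertices L S).val ∧
    vertsOf (insertVertices L S).val = vertsOf S ∪ L.toFinset ∧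
    edgesOf (insertVertices L S).val = edgesOf S ∧
    (insertVertices L S).time = L.length ∧
    statePotential (insertVertices L S).val = statePotential S := by
  induction L generalizing S with
  | nil => simp [insertVertices, hS]
  | cons v L ih =>
    obtain ⟨hv, hnd'⟩ := List.nodup_cons.1 hnd
    have ev : (insertVertices (v :: L) S).val =
      (insertVertices L (⟨single (vtx v), {v}, ∅⟩ :: S)).val := rfl
    have et : (insertVertices (v :: L) S).time =
      1 + (insertVertices L (⟨single (vtx v), {v}, ∅⟩ :: S)).time := rfl
    obtain ⟨s₁, s₂, s₃⟩ := single_spec v {v}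
    obtain ⟨i₁, i₂, i₃, i₄, i₅⟩ := ih (S := ⟨single (vtx v), {v}, ∅⟩ :: S)
      (valid_cons.2 ⟨s₁, by rw [s₂]; simpa using hL v (by simp), hS⟩) hnd' (fun w hw => by
        rw [vertsOf, s₂, Finset.mem_union, Finset.mem_singleton, not_or]
        exact ⟨fun h => hv (h ▸ hw), hL w (by simp [hw])⟩)
    rw [ev, et]
    refine ⟨i₁, ?_, ?_, by rw [i₄, List.length_cons, add_comm], ?_⟩
    · rw [i₂, vertsOf, s₂]
      ext w
      simp only [Finset.mem_union, Finset.mem_singleton, List.toFinset_cons, Finset.mem_insert]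
      tauto
    · rw [i₃, edgesOf, s₃, Finset.empty_union]
    · rw [i₅, statePotential_cons, statePotential]
      simp

theorem insertEdge_of_mem
    (h : vtx u ∈ (findCC v ((findCC u S).val.1 :: (findCC u S).val.2)).val.1.tree.toList) :
    ∀ g, g = findCC v ((findCC u S).val.1 :: (findCC u S).val.2) →
    (insertEdge u v S).val =
      ⟨g.val.1.tree, g.val.1.verts, insert s(u, v) g.val.1.nontree⟩ :: g.val.2 ∧
    (insertEdge u v S).time = (findCC u S).time + (g.time + 2) := by
  rintro g rfl
  simp [insertEdge, h]

theorem insertEdge_of_notMem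
    (h : vtx u ∉ (findCC v ((findCC u S).val.1 :: (findCC u S).val.2)).val.1.tree.toList) :
    ∀ g, g = findCC v ((findCC u S).val.1 :: (findCC u S).val.2) →
    ∀ h, h = extract u g.val.2 →
    (insertEdge u v S).val = ⟨(link u v h.1.tree g.val.1.tree).val, h.1.verts,
      h.1.nontree ∪ g.val.1.nontree⟩ :: h.2 ∧
    (insertEdge u v S).time = (findCC u S).time + (g.time + (1 +
      ((link u v h.1.tree g.val.1.tree).time +
        (min h.1.nontree.card g.val.1.nontree.card + 1 + 1)))) := by
  rintro g rfl h rfl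
  simp [insertEdge, h, hashUnion]

/-- The costs are two splays and then either one insertion, which raises the entropy part by O(log
|V|), or a link and a union of hash sets, whose time is paid by the drop of the entropy part. -/
theorem insertEdge_spec (hS : Valid S) (hu : u ∈ vertsOf S) (hv : v ∈ vertsOf S) (hne : u ≠ v)
    (he : s(u, v) ∉ edgesOf S) :
    Valid (insertEdge u v S).val ∧
    vertsOf (insertEdge u v S).val = vertsOf S ∧
    edgesOf (insertEdge u v S).val = insert s(u, v) (edgesOf S) ∧
    (insertEdge u v S).time + statePotential (insertEdge u v S).val ≤
      statePotential S + 1000 * Real.log (vertsOf S).card := by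
  have hn := Valid.two_le_card hu hv hne
  have hlog := one_le_two_log hn
  obtain ⟨f₁, f₂, f₃, f₄, f₅, f₆⟩ := findCC_spec hS hu
  have hsz := f₁.log_size_le (f₂ ▸ hn)
  obtain ⟨g₁, g₂, g₃, g₄, g₅, g₆⟩ := findCC_spec f₁ (f₂ ▸ hv)
  have hsz' := g₁.log_size_le (by rwa [g₂, f₂])
  by_cases hmem :
    vtx u ∈ (findCC v ((findCC u S).val.1 :: (findCC u S).val.2)).val.1.tree.toList
  · obtain ⟨ev, et⟩ := insertEdge_of_mem hmem _ rfl
    rw [ev, et]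
    generalize findCC v ((findCC u S).val.1 :: (findCC u S).val.2) = g at *
    obtain ⟨⟨c, R⟩, tg⟩ := g
    simp only at *
    rw [f₂] at g₂
    rw [f₃] at g₃
    obtain ⟨hc, hd, hR⟩ := valid_cons.1 g₁
    have hu' : u ∈ c.treeVerts := Component.mem_treeVerts.2 hmem
    have he' : s(u, v) ∉ c.treeEdges ∧ s(u, v) ∉ c.nontree := by
      rw [← g₃, edgesOf, Component.allEdges] at he
      simp only [Finset.mem_union, not_or] at he
      exact he.1
    obtain ⟨m₁, m₂, m₃⟩ := Component.valid_of_tour (A := c.verts)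
      (N := insert s(u, v) c.nontree) hc.tour
      (by
        intro e he w hw
        rcases Finset.mem_insert.1 he with rfl | he
        · rcases Sym2.mem_iff.1 hw with rfl | rfl
          · exact hu'
          · exact g₄
        · exact hc.nontree_mem e he w hw)
      (Finset.disjoint_insert_right.2 ⟨he'.1, hc.disjoint_edges⟩)
    have hE : edgesOf (⟨c.tree, c.verts, insert s(u, v) c.nontree⟩ :: R) =
        insert s(u, v) (edgesOf S) := by
      rw [← g₃, edgesOf, m₃, edgesOf, Component.allEdges, Finset.union_insert,
        Finset.insert_union]
    have hV : Valid (⟨c.tree, c.verts, insert s(u, v) c.nontree⟩ :: R) :=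
      valid_cons.2 ⟨m₁, by rwa [m₂], hR⟩
    have hVv : vertsOf (⟨c.tree, c.verts, insert s(u, v) c.nontree⟩ :: R) = vertsOf S := by
      rw [← g₂, vertsOf, m₂, vertsOf]
    refine ⟨hV, hVv, hE, ?_⟩
    -- Applied to the state after the insertion: M + 1 ≤ |V|², so the increase log (M + 1) + 1 of M
    -- log M is O(log |V|).
    have hM := hV.nontreeCard_le.trans hV.card_edgesOf_le
    rw [nontreeCard_cons, hVv, Finset.card_insert_of_notMem he'.2, Nat.add_right_comm] at hM
    have h₁ := log_natCast_mono hM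
    rw [Nat.cast_pow, Real.log_pow] at h₁
    have h₂ := mulLog_succ_le (c.nontree.card + nontreeCard R)
    have h₃ := mulLog_mono (Nat.le_succ c.nontree.card)
    rw [statePotential_cons, Finset.card_insert_of_notMem he'.2, Nat.add_right_comm]
    rw [statePotential_cons c] at g₆
    rw [g₂] at hsz'
    rw [f₂] at hsz
    push_cast at *
    linarith
  · obtain ⟨ev, et⟩ := insertEdge_of_notMem hmem _ rfl _ rfl
    rw [ev, et]
    generalize findCC v ((findCC u S).val.1 :: (findCC u S).val.2) = g at *
    obtain ⟨⟨c, R⟩, tg⟩ := g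
    simp only at *
    rw [f₂] at g₂
    rw [f₃] at g₃
    obtain ⟨hc, hd, hR⟩ := valid_cons.1 g₁
    have huR : u ∈ vertsOf R := by
      rw [← g₂, vertsOf, Finset.mem_union] at hu
      exact hu.resolve_left (mt Component.mem_treeVerts.1 hmem)
    obtain ⟨x₁, x₂⟩ := extract_spec huR
    generalize extract u R = x at *
    obtain ⟨d, Q⟩ := x
    simp only at *
    obtain ⟨hd', hdQ, hQ⟩ := valid_cons.1 (hR.perm x₁)
    rw [vertsOf_perm x₁, vertsOf, Finset.disjoint_union_right] at hd
    have hdc : Disjoint d.treeVerts c.treeVerts := hd.1.symm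
    -- The component `d` of `u` is read off without a further splay; `findCC u` has already been
    -- charged.
    obtain ⟨l₁, l₂, -, l₄⟩ := link_spec hd'.tour hc.tour hdc x₂ g₄
    have hp : Valid (c :: d :: Q) := g₁.perm (x₁.cons c)
    have hEE : edgesOf S = c.allEdges ∪ (d.allEdges ∪ edgesOf Q) := by
      rw [← g₃, edgesOf, edgesOf_perm x₁, edgesOf]
    have hVV : vertsOf S = c.treeVerts ∪ (d.treeVerts ∪ vertsOf Q) := by
      rw [← g₂, vertsOf, vertsOf_perm x₁, vertsOf]
    have hEd : Disjoint c.allEdges d.allEdges := by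
      have := disjoint_edgesOf hp
      rw [edgesOf, Finset.disjoint_union_right] at this
      exact this.1
    rw [Component.allEdges, Component.allEdges, Finset.disjoint_union_left,
      Finset.disjoint_union_right, Finset.disjoint_union_right] at hEd
    have heN : s(u, v) ∉ d.nontree ∪ c.nontree := by
      rw [hEE] at he
      simp only [Component.allEdges, Finset.mem_union, not_or] at he ⊢
      exact ⟨he.2.1.2, he.1.2⟩
    obtain ⟨m₁, m₂, m₃⟩ := Component.valid_of_tour (A := d.verts)
      (N := d.nontree ∪ c.nontree) l₁
      (by
        intro e he w hw
        rcases Finset.mem_union.1 he with he | he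
        · exact Finset.mem_union_left _ (hd'.nontree_mem e he w hw)
        · exact Finset.mem_union_right _ (hc.nontree_mem e he w hw))
      (by
        rw [Finset.disjoint_insert_left, Finset.disjoint_union_left,
          Finset.disjoint_union_right, Finset.disjoint_union_right]
        exact ⟨heN, ⟨hd'.disjoint_edges, hEd.2.1.symm⟩, hEd.1.2, hc.disjoint_edges⟩)
    have hsize : (link u v d.tree c.tree).val.size ≤ 3 * (vertsOf S).card := by
      refine m₁.size_le.trans (Nat.mul_le_mul_left 3 (Finset.card_le_card ?_))
      rw [m₂, hVV, Finset.union_comm, ← Finset.union_assoc]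
      exact Finset.subset_union_left
    have hlogl := log_three_mul_le hn hsize
    rw [l₂] at hlogl
    refine ⟨valid_cons.2 ⟨m₁, ?_, hQ⟩, ?_, ?_, ?_⟩
    · rw [m₂]
      exact Finset.disjoint_union_left.2 ⟨hdQ, hd.2⟩
    · rw [vertsOf, m₂, hVV, Finset.union_comm d.treeVerts, Finset.union_assoc]
    · rw [edgesOf, m₃, hEE, Component.allEdges, Component.allEdges, Finset.insert_union,
        Finset.insert_union, Finset.union_union_union_comm, Finset.union_comm (d.treeEdges ∪ _),
        Finset.union_assoc]
    · have hcard := Finset.card_union_of_disjoint hEd.2.2.symm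
      have h₁ := min_le_mulLog d.nontree.card c.nontree.card
      rw [statePotential_cons, hcard]
      rw [statePotential_perm (x₁.cons c), statePotential_cons c, treePotential_cons,
        nontreeCard_cons, nontreeLog_cons, ← Nat.add_assoc,
        Nat.add_comm c.nontree.card d.nontree.card] at g₆
      rw [g₂] at hsz'
      rw [f₂] at hsz
      push_cast at *
      linarith

theorem insertEdges_spec {L : List (α × α)} {n : ℕ} (hS : Valid S) (hnd : (undirected L).Nodup)
    (hL : ∀ e ∈ undirected L, e ∉ edgesOf S ∧ ¬ e.IsDiag ∧ ∀ v ∈ e, v ∈ vertsOf S)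
    (hn : (vertsOf S).card = n) :
    Valid (insertEdges L S).val ∧
    vertsOf (insertEdges L S).val = vertsOf S ∧
    edgesOf (insertEdges L S).val = edgesOf S ∪ (undirected L).toFinset ∧
    (insertEdges L S).time + statePotential (insertEdges L S).val ≤
      statePotential S + L.length * (1000 * Real.log n) := by
  induction L generalizing S with
  | nil => simp [insertEdges, undirected, hS]
  | cons p L ih =>
    obtain ⟨h₁, h₂, h₃⟩ := hL s(p.1, p.2) (by simp [undirected])
    obtain ⟨d₁, d₂, d₃, d₄⟩ := insertEdge_spec hS (h₃ p.1 (by simp)) (h₃ p.2 (by simp))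
      (by simpa using h₂) h₁
    have hnd' : s(p.1, p.2) ∉ undirected L ∧ (undirected L).Nodup := List.nodup_cons.1 hnd
    have ev : (insertEdges (p :: L) S).val =
      (insertEdges L (insertEdge p.1 p.2 S).val).val := rfl
    have et : (insertEdges (p :: L) S).time = (insertEdge p.1 p.2 S).time +
      (insertEdges L (insertEdge p.1 p.2 S).val).time := rfl
    rw [ev, et]
    generalize insertEdge p.1 p.2 S = r at *
    obtain ⟨i₁, i₂, i₃, i₄⟩ := ih (S := r.val) d₁ hnd'.2 (fun e he => by
        rw [d₃, d₂, Finset.mem_insert, not_or]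
        have := hL e (by simp only [undirected, List.map_cons, List.mem_cons] at he ⊢; exact Or.inr he)
        exact ⟨⟨fun h => hnd'.1 (h ▸ he), this.1⟩, this.2⟩) (d₂ ▸ hn)
    refine ⟨i₁, i₂.trans d₂, ?_, ?_⟩
    · rw [i₃, d₃, undirected, undirected, List.map_cons, List.toFinset_cons]
      ext e; simp only [Finset.mem_union, Finset.mem_insert]; tauto
    · rw [hn] at d₄
      rw [List.length_cons]
      push_cast
      linarith

end Updates

/-! ### The amortized bounds in terms of the graph. -/

section Main

variable {α : Type*} [DecidableEq α] {S : List (Component α)} {G H : FinGraph α} {Vd : List α}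
  {Ed : List (α × α)}

/-- Once the edges are gone, the vertices in `Vd` are isolated because `H` is a graph without them.
The term 4 |V| is one step per deleted vertex plus 3 |V| for `rebuild`. -/
theorem decUpdateCC_spec {ord : Finset (Sym2 α) → List (α × α)} (hord : IsEnumeration ord)
    (hD : Deletion G Vd Ed H) (hS : Represents S G) :
    Represents (decUpdateCC ord S Vd Ed).val H ∧
    (decUpdateCC ord S Vd Ed).time ≤
      Ed.length * (200 * G.edges.card) + 4 * G.verts.card ∧
    (decUpdateCC ord S Vd Ed).time + statePotential (decUpdateCC ord S Vd Ed).val ≤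
      statePotential S + Ed.length * (1000 * (Real.log G.verts.card + G.edges.card)) +
        4 * G.verts.card := by
  obtain ⟨hV, -, hv, he⟩ := represents_iff.1 hS
  obtain ⟨d₁, d₂, d₃, d₄, d₅⟩ := deleteEdges_spec hord hV hD.nodup_edges
    (fun e h => ⟨he ▸ hD.subset_edges e h, G.loopless e (hD.subset_edges e h)⟩)
    (n := G.verts.card) (m := G.edges.card) (by rw [hv]) (by rw [he])
  rw [hv] at d₂
  rw [he, ← hD.edges] at d₃
  have hval : (decUpdateCC ord S Vd Ed).val =
    (rebuild (deleteVertices Vd (deleteEdges ord Ed S).val).val).val := rfl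
  have htime : (decUpdateCC ord S Vd Ed).time = (deleteEdges ord Ed S).time +
    ((deleteVertices Vd (deleteEdges ord Ed S).val).time +
    (rebuild (deleteVertices Vd (deleteEdges ord Ed S).val).val).time) := rfl
  rw [hval, htime]
  generalize deleteEdges ord Ed S = r at *
  obtain ⟨v₁, v₂, v₃, v₄, v₅⟩ := deleteVertices_spec (L := Vd) d₁ (by
    intro v hv e he hve
    rw [d₃] at he
    have := H.mem_verts e he v hve
    rw [hD.verts] at this
    exact (Finset.mem_sdiff.1 this).2 (List.mem_toFinset.2 hv))
  generalize deleteVertices Vd r.val = q at *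
  rw [d₂, ← hD.verts] at v₂
  obtain ⟨b₁, b₂, b₃⟩ := rebuild_represents v₁ v₂ (v₃.trans d₃)
  have h₁ : Vd.length ≤ G.verts.card := by
    rw [← List.toFinset_card_of_nodup hD.nodup_verts]
    exact Finset.card_le_card fun v hv => hD.subset_verts v (List.mem_toFinset.1 hv)
  have h₂ : H.verts.card ≤ G.verts.card := by
    rw [hD.verts]; exact Finset.card_le_card Finset.sdiff_subset
  refine ⟨b₁, by omega, ?_⟩
  have h₃ : (q.time : ℝ) + (rebuild q.val).time ≤ 4 * G.verts.card := by
    exact_mod_cast (by omega)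
  rw [b₃]
  push_cast
  linarith

theorem incUpdateCC_spec (hD : Deletion G Vd Ed H) (hS : Represents S H) :
    Represents (incUpdateCC S Vd Ed).val G ∧
    (incUpdateCC S Vd Ed).time + statePotential (incUpdateCC S Vd Ed).val ≤
      statePotential S + Ed.length * (1000 * Real.log G.verts.card) + 4 * G.verts.card := by
  obtain ⟨hV, -, hv, he⟩ := represents_iff.1 hS
  obtain ⟨v₁, v₂, v₃, v₄, v₅⟩ := insertVertices_spec hV hD.nodup_verts (by
    intro v h h'
    rw [hv, hD.verts] at h'
    exact (Finset.mem_sdiff.1 h').2 (List.mem_toFinset.2 h))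
  have hval : (incUpdateCC S Vd Ed).val =
    (rebuild (insertEdges Ed (insertVertices Vd S).val).val).val := rfl
  have htime : (incUpdateCC S Vd Ed).time = (insertVertices Vd S).time +
    ((insertEdges Ed (insertVertices Vd S).val).time +
    (rebuild (insertEdges Ed (insertVertices Vd S).val).val).time) := rfl
  rw [hval, htime]
  generalize insertVertices Vd S = r at *
  have hsub : Vd.toFinset ⊆ G.verts := fun v hv => hD.subset_verts v (List.mem_toFinset.1 hv)
  have hsub' : (undirected Ed).toFinset ⊆ G.edges := fun e he =>
    hD.subset_edges e (List.mem_toFinset.1 he)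
  rw [hv, hD.verts, Finset.sdiff_union_of_subset hsub] at v₂
  rw [he, hD.edges] at v₃
  obtain ⟨e₁, e₂, e₃, e₄⟩ := insertEdges_spec (L := Ed) (n := G.verts.card) v₁ hD.nodup_edges (by
    intro e h
    rw [v₃, v₂]
    have hG := hD.subset_edges e h
    exact ⟨fun h' => (Finset.mem_sdiff.1 h').2 (List.mem_toFinset.2 h), G.loopless e hG,
      G.mem_verts e hG⟩) (by rw [v₂])
  rw [v₂] at e₂
  rw [v₃, Finset.sdiff_union_of_subset hsub'] at e₃
  generalize insertEdges Ed r.val = q at *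
  obtain ⟨b₁, b₂, b₃⟩ := rebuild_represents e₁ e₂ e₃
  have h₁ : Vd.length ≤ G.verts.card := by
    rw [← List.toFinset_card_of_nodup hD.nodup_verts]
    exact Finset.card_le_card hsub
  refine ⟨b₁, ?_⟩
  have h₃ : (r.time : ℝ) + (rebuild q.val).time ≤ 4 * G.verts.card := by
    exact_mod_cast (by omega)
  rw [b₃]
  push_cast
  linarith

theorem findCC_amortized {v : α} (hS : Represents S G) (hv : v ∈ G.verts) :
    v ∈ (findCC v S).val.1.verts ∧
    Represents ((findCC v S).val.1 :: (findCC v S).val.2) G ∧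
    (findCC v S).time + (findCC v S).val.1.tree.potential ≤
      (extract v S).1.tree.potential + 1000 * (1 + Real.log G.verts.card) := by
  obtain ⟨hV, hw, hv', he⟩ := represents_iff.1 hS
  rw [← hv'] at hv
  obtain ⟨p, hm⟩ := extract_spec hv
  obtain ⟨t₁, -, t₃⟩ := findCC_tree hv
  obtain ⟨f₁, f₂, f₃, f₄, -, -⟩ := findCC_spec hV hv
  have e₁ : (findCC v S).val.1.verts = (extract v S).1.verts := rfl
  have e₂ : (findCC v S).val.2 = (extract v S).2 := rfl
  have e₃ : (findCC v S).val.1.treeVerts = (extract v S).1.treeVerts := by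
    simp only [Component.treeVerts, t₁]
  have hw' : ∀ c ∈ (extract v S).1 :: (extract v S).2, c.verts = c.treeVerts :=
    fun c hc => hw c (p.mem_iff.2 hc)
  refine ⟨?_, represents_iff.2 ⟨f₁, ?_, f₂.trans hv', f₃.trans he⟩, ?_⟩
  · rw [e₁, hw' _ (by simp)]; exact hm
  · intro c hc
    rcases List.mem_cons.1 hc with rfl | hc
    · rw [e₁, e₃, hw' _ (by simp)]
    · exact hw' c (List.mem_cons_of_mem _ (e₂ ▸ hc))
  · have hc := hV.perm p
    have hsize := (valid_cons.1 hc).1.size_le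
    have hcard := card_vertsOf_cons hc
    have hpos : 0 < (vertsOf S).card := Finset.card_pos.2 ⟨v, hv⟩
    have h₁ := log_natCast_mono (a := (extract v S).1.tree.size) (b := 3 * (vertsOf S).card) (by
      rw [vertsOf_perm p]; omega)
    -- This gives log (3n) ≤ log n + 2, also for n = 1, where `log_three_mul_le` does not apply;
    -- hence the summand 1 in the bound.
    have h₂ := Real.log_le_sub_one_of_pos (x := 3) (by norm_num)
    rw [Nat.cast_mul, Real.log_mul (by norm_num) (by positivity)] at h₁
    have h₃ := Real.log_natCast_nonneg (vertsOf S).card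
    rw [← hv']
    push_cast at h₁
    linarith

/-- A tree with an edge has two vertices, so log |W| alone absorbs the additive constant of
`cut_spec`. -/
theorem cut_amortized {u v : α} {t : SplayTree (TourNode α)} {W : Finset α} {F : Finset (Sym2 α)}
    (ht : IsEulerTour t.toList W F) (huv : s(u, v) ∈ F) :
    (cut u v t).time + (cut u v t).val.1.potential + (cut u v t).val.2.potential ≤
      t.potential + 1000 * Real.log W.card := by
  obtain ⟨-, -, -, h⟩ := cut_spec ht huv
  obtain ⟨h₁, h₂⟩ := ht.edge_mem _ huv
  have hW : 2 ≤ W.card := Finset.one_lt_card.2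
    ⟨u, h₂ u (by simp), v, h₂ v (by simp), by simpa using h₁⟩
  have h₃ := one_le_two_log hW
  have h₄ := log_three_mul_le (m := t.size) hW (by
    have := ht.length_le
    have := ht.card_eq
    rw [size_eq_length]; omega)
  linarith

theorem link_amortized {u v : α} {s t : SplayTree (TourNode α)} {W₁ W₂ : Finset α}
    {F₁ F₂ : Finset (Sym2 α)} (hs : IsEulerTour s.toList W₁ F₁) (ht : IsEulerTour t.toList W₂ F₂)
    (hW : Disjoint W₁ W₂) (hu : u ∈ W₁) (hv : v ∈ W₂) :
    (link u v s t).time + (link u v s t).val.potential ≤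
      s.potential + t.potential + 1000 * Real.log (W₁ ∪ W₂).card := by
  obtain ⟨h₀, h₁, -, h₂⟩ := link_spec hs ht hW hu hv
  have hn : 2 ≤ (W₁ ∪ W₂).card := Finset.one_lt_card.2
    ⟨u, by simp [hu], v, by simp [hv], fun e => Finset.disjoint_left.1 hW hu (e ▸ hv)⟩
  have h₃ := one_le_two_log hn
  have h₄ := log_three_mul_le (m := (link u v s t).val.size) hn (by
    have := h₀.length_le
    have := h₀.card_eq
    rw [size_eq_length]; omega)
  rw [h₁] at h₄
  linarith

end Main

end DynCC

theorem theorem2 :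
    ∃ C : ℝ, 0 < C ∧ ∀ (α : Type*) [DecidableEq α],
      -- `FindCC`, `Cut` and `Link` run in amortized logarithmic time
      (∃ φ : SplayTree (TourNode α) → ℝ,
        (∀ t, 0 ≤ φ t ∧ φ t ≤ C * (t.size * Real.log t.size)) ∧
        (∀ (S : List (Component α)) (G : FinGraph α) (v : α),
          Represents S G → v ∈ G.verts →
            v ∈ (findCC v S).val.1.verts ∧
            Represents ((findCC v S).val.1 :: (findCC v S).val.2) G ∧
            (findCC v S).time + φ (findCC v S).val.1.tree ≤
              φ (extract v S).1.tree + C * (1 + Real.log G.verts.card)) ∧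
        (∀ (t : SplayTree (TourNode α)) (W : Finset α) (F : Finset (Sym2 α)) (u v : α),
          IsEulerTour t.toList W F → s(u, v) ∈ F →
            (∃ W₁ W₂ F₁ F₂, u ∈ W₁ ∧ v ∈ W₂ ∧ Disjoint W₁ W₂ ∧ W₁ ∪ W₂ = W ∧
              F₁ ∪ F₂ = F.erase s(u, v) ∧
              IsEulerTour (cut u v t).val.1.toList W₁ F₁ ∧
              IsEulerTour (cut u v t).val.2.toList W₂ F₂) ∧
            (cut u v t).time + φ (cut u v t).val.1 + φ (cut u v t).val.2 ≤
              φ t + C * Real.log W.card) ∧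
        (∀ (t₁ t₂ : SplayTree (TourNode α)) (W₁ W₂ : Finset α) (F₁ F₂ : Finset (Sym2 α)) (u v : α),
          IsEulerTour t₁.toList W₁ F₁ → IsEulerTour t₂.toList W₂ F₂ → Disjoint W₁ W₂ →
          u ∈ W₁ → v ∈ W₂ →
            IsEulerTour (link u v t₁ t₂).val.toList (W₁ ∪ W₂) (insert s(u, v) (F₁ ∪ F₂)) ∧
            (link u v t₁ t₂).time + φ (link u v t₁ t₂).val ≤
              φ t₁ + φ t₂ + C * Real.log (W₁ ∪ W₂).card)) ∧
      -- the two update algorithms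
      ∃ Φ : List (Component α) → ℝ,
        (∀ S, 0 ≤ Φ S) ∧
        (∀ S G, Represents S G →
          Φ S ≤ C * ((G.verts.card + G.edges.card) * Real.log G.verts.card)) ∧
        ∀ (S : List (Component α)) (G H : FinGraph α) (Vd : List α) (Ed : List (α × α)),
          Deletion G Vd Ed H →
          -- `DecUpdateCC`, from `G` to `H`
          (∀ ord : Finset (Sym2 α) → List (α × α), IsEnumeration ord → Represents S G →
            Represents (decUpdateCC ord S Vd Ed).val H ∧
            (decUpdateCC ord S Vd Ed).time ≤
              C * (Ed.length * (Real.log G.verts.card + G.edges.card) + G.verts.card) ∧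
            (decUpdateCC ord S Vd Ed).time + Φ (decUpdateCC ord S Vd Ed).val ≤
              Φ S + C * (Ed.length * (Real.log G.verts.card + G.edges.card) + G.verts.card)) ∧
          -- `IncUpdateCC`, from `H` to `G`
          (Represents S H →
            Represents (incUpdateCC S Vd Ed).val G ∧
            (incUpdateCC S Vd Ed).time + Φ (incUpdateCC S Vd Ed).val ≤
              Φ S + C * (Ed.length * Real.log G.verts.card + G.verts.card)) := by
  -- Any constant above those of the lemmas will do; 1000 is the largest coefficient occurring in
  -- them.
  refine ⟨1000, by norm_num, fun α _ => ⟨⟨SplayTree.potential, fun t => ⟨t.potential_nonneg, ?_⟩,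
    fun S G v hS hv => findCC_amortized hS hv,
    fun t W F u v ht huv => ⟨(cut_spec ht huv).1, cut_amortized ht huv⟩,
    fun s t W₁ W₂ F₁ F₂ u v hs ht hW hu hv =>
      ⟨(link_spec hs ht hW hu hv).1, link_amortized hs ht hW hu hv⟩⟩,
    statePotential, statePotential_nonneg, fun S G hS => ?_, fun S G H Vd Ed hD =>
    ⟨fun ord hord hS => ?_, fun hS => ?_⟩⟩⟩
  · have := t.potential_le
    have : 0 ≤ t.size * Real.log t.size :=
      mul_nonneg (Nat.cast_nonneg _) (Real.log_natCast_nonneg _)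
    linarith
  · obtain ⟨hV, -, hv, he⟩ := represents_iff.1 hS
    have h₁ := hV.statePotential_le
    rw [hv, he] at h₁
    have : 0 ≤ ((G.verts.card : ℝ) + G.edges.card) * Real.log G.verts.card :=
      mul_nonneg (by positivity) (Real.log_natCast_nonneg _)
    linarith
  · obtain ⟨h₁, h₂, h₃⟩ := decUpdateCC_spec hord hD hS
    have h₄ : ((decUpdateCC ord S Vd Ed).time : ℝ) ≤
        Ed.length * (200 * G.edges.card) + 4 * G.verts.card := by exact_mod_cast h₂
    have h₅ : 0 ≤ (Ed.length : ℝ) * Real.log G.verts.card :=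
      mul_nonneg (Nat.cast_nonneg _) (Real.log_natCast_nonneg _)
    have h₆ : 0 ≤ (Ed.length : ℝ) * G.edges.card := by positivity
    have h₇ : 0 ≤ (G.verts.card : ℝ) := Nat.cast_nonneg _
    exact ⟨h₁, by linarith, by linarith⟩
  · obtain ⟨h₁, h₂⟩ := incUpdateCC_spec hD hS
    have h₇ : 0 ≤ (G.verts.card : ℝ) := Nat.cast_nonneg _
    exact ⟨h₁, by linarith⟩
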